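/- **Theorem 5.3 (rates of convergence for classical solutions).** Let $d\ge 1$ and let $\Omega\subset\mathbb R^d$ be a nonempty bounded open convex set that is uniformly convex: for some $R>0$ every boundary point of $\Omega$ lies on the boundary sphere of a closed ball of radius $R$ containing $\Omega$. Let $f_0>0$, $\sigma,\kappa\in\mathbb R$. There is a constant $C>0$, depending only on $d,\Omega,f_0$ and the mesh regularity constants $\sigma,\kappa$, such that the following holds. Let $k\in\{0,1\}$, $0<\alpha\le 1$, and let $f\ge f_0$ in $\Omega$. Let $u\in C^{2+k,\alpha}(\overline\Omega)$ be a convex function with $\det D^2u=f$ in $\Omega$ and $u=g$ on $\partial\Omega$. Write $|u|_{W^2_\infty}=\sup_{\Omega}\|D^2u\|$ and $|u|_{C^{2+k,\alpha}}=\sup_{x\ne y\in\Omega}\|D^{2+k}u(x)-D^{2+k}u(y)\|/|x-y|^\alpha$ (operator norms), assume $|u|_{C^{2+k,\alpha}}>0$, and put $$R_k(u)=|u|_{W^2_\infty}^{\frac1{2+k+\alpha}}\,|u|_{C^{2+k,\alpha}}^{-\frac1{2+k+\alpha}} .$$ Let $\mathcal T_h$ be a finite conforming simplicial mesh whose elements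 $T$ have maximal diameter $h$. Each $T$ contains a ball of some diameter $\varrho_T>0$ with $\operatorname{diam}T\le\sigma\varrho_T$, and $h\le\kappa\operatorname{diam}T$. The computational domain $\Omega_h=\bigcup T$ is convex, and all nodes on $\partial\Omega_h$ (the boundary nodes) lie on $\partial\Omega$; the other nodes are called interior. Let $$\delta=R_k(u)\,h^{\frac{2}{2+k+\alpha}},\qquad \theta=R_k(u)^{-1}\,h^{\frac{k+\alpha}{2+k+\alpha}} .$$ Let $\mathbb S_\theta$ be a finite set of unit vectors such that every unit vector is within distance $\theta$ of it. Let $\mathbb S^\perp_\theta$ be a finite set of orthonormal bases of $\mathbb R^d$ such that for every orthonormal basis $(v_j)_{j=1}^d$ there is $(w_j)_{j=1}^d\in\mathbb S^\perp_\theta$ with $w_j\in\mathbb S_\theta$ and $|v_j-w_j|\le\theta$ for all $j$. For a continuous function $w$ on $\Omega_h$, an interior node $x_i$ and a unit vector $v$ let $\hat\delta=\min\{\delta,\operatorname{dist}(x_i,\mathbb R^d\setminus\Omega_h)\}$, $$\nabla^2_\delta w(x_i;v)=\frac{w(x_i+\hat\delta v)-2w(x_i)+w(x_i-\hat\delta v)}{\hat\delta^2},$$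 $$T_\varepsilon[w](x_i)=\min_{(v_j)\in\mathbb S^\perp_\theta}\Big(\prod_{j=1}^d\max\{\nabla^2_\delta w(x_i;v_j),0\}+\sum_{j=1}^d\min\{\nabla^2_\delta w(x_i;v_j),0\}\Big).$$ Let $u_\varepsilon$ be the discrete solution: a continuous function on $\Omega_h$, affine on every element, with $u_\varepsilon(x_i)=g(x_i)$ at the boundary nodes and $T_\varepsilon[u_\varepsilon](x_i)=f(x_i)$ at the interior nodes. Then $$\|u-u_\varepsilon\|_{L^\infty(\Omega_h)}\le C\Big(|u|_{C^{2+k,\alpha}}^{\frac1{2+k+\alpha}}\,|u|_{W^2_\infty}^{\,d-\frac1{2+k+\alpha}}+\big(1+R_k(u)\big)\,|u|_{W^2_\infty}\Big)\,h^{\frac{k+\alpha}{2+k+\alpha}} .$$ -/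

import Mathlib

namespace TwoScaleMA

/-- The Euclidean space `ℝ^d`. -/
abbrev Space (d : ℕ) : Type := EuclideanSpace ℝ (Fin d)

/-! ### The continuous problem -/

/-- A bounded, nonempty, open convex set which is uniformly convex: there is one radius `R` such
that every boundary point lies on the boundary sphere of a closed ball of radius `R` containing
the set (enclosing sphere condition; for `C²` domains this says that the principal curvatures of
the boundary are bounded below by a positive number). -/
structure IsUniformlyConvexDomain {d : ℕ} (Ω : Set (Space d)) : Prop where
  isOpen : IsOpen Ω
  nonempty : Ω.Nonempty
  isBounded : Bornology.IsBounded Ω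
  convex : Convex ℝ Ω
  enclosing : ∃ R : ℝ, 0 < R ∧ ∀ z ∈ frontier Ω, ∃ c : Space d,
    dist z c = R ∧ Ω ⊆ Metric.closedBall c R

/-- `u ∈ C^{m,α}(closure Ω)` for an open set `Ω`: `u` is of class `C^m` in `Ω`, `u` is continuous on
the closure, all derivatives of order at most `m` extend continuously to the closure, and the
derivative of order `m` is Hölder continuous with exponent `α`. -/
structure IsHolderClass {d : ℕ} (m : ℕ) (α : ℝ) (Ω : Set (Space d)) (u : Space d → ℝ) : Prop where
  continuousOn : ContinuousOn u (closure Ω)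
  contDiffOn : ContDiffOn ℝ m u Ω
  extends_closure : ∀ j : ℕ, j ≤ m → ∃ F : Space d → (Space d) [×j]→L[ℝ] ℝ,
    ContinuousOn F (closure Ω) ∧ Set.EqOn F (iteratedFDeriv ℝ j u) Ω
  holder : ∃ K : ℝ, ∀ x ∈ Ω, ∀ y ∈ Ω,
    ‖iteratedFDeriv ℝ m u x - iteratedFDeriv ℝ m u y‖ ≤ K * ‖x - y‖ ^ α

/-- The Hölder seminorm `|u|_{C^{m,α}}`: the supremum over `x ≠ y` in `Ω` of
`‖D^m u(x) - D^m u(y)‖ / |x - y|^α`. -/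
noncomputable def holderSeminorm {d : ℕ} (m : ℕ) (α : ℝ) (Ω : Set (Space d))
    (u : Space d → ℝ) : ℝ :=
  sSup {r : ℝ | ∃ x ∈ Ω, ∃ y ∈ Ω, x ≠ y ∧
    r = ‖iteratedFDeriv ℝ m u x - iteratedFDeriv ℝ m u y‖ / ‖x - y‖ ^ α}

/-- The seminorm `|u|_{W²_∞(Ω)}` of a function of class `C²` in the open set `Ω`: the supremum of
`‖D²u(x)‖` over `Ω` (for continuous `D²u` it is the essential supremum). -/
noncomputable def w2InfSeminorm {d : ℕ} (Ω : Set (Space d)) (u : Space d → ℝ) : ℝ :=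
  sSup {r : ℝ | ∃ x ∈ Ω, r = ‖iteratedFDeriv ℝ 2 u x‖}

/-- The Hessian matrix `D²u(x)` of second partial derivatives. -/
noncomputable def hessian {d : ℕ} (u : Space d → ℝ) (x : Space d) : Matrix (Fin d) (Fin d) ℝ :=
  Matrix.of fun i j =>
    iteratedFDeriv ℝ 2 u x ![EuclideanSpace.single i 1, EuclideanSpace.single j 1]

/-- `u` is a convex function on `closure Ω` with `det D²u = f` in `Ω` and `u = g` on `∂Ω`,
pointwise. (The regularity of `u` is stated separately.) -/
structure IsConvexSolution {d : ℕ} (Ω : Set (Space d)) (f g u : Space d → ℝ) : Prop where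
  convexOn : ConvexOn ℝ (closure Ω) u
  det_eq : ∀ x ∈ Ω, (hessian u x).det = f x
  boundary : ∀ x ∈ frontier Ω, u x = g x

/-- The quotient `R = (|u|_{W²_∞} / |u|_{C^{2+k,α}})^{1/(2+k+α)}`, written as a product of powers. -/
noncomputable def scaleRatio {d : ℕ} (k : ℕ) (α : ℝ) (Ω : Set (Space d)) (u : Space d → ℝ) : ℝ :=
  w2InfSeminorm Ω u ^ (1 / (2 + k + α)) *
    holderSeminorm (2 + k) α Ω u ^ (-(1 / (2 + k + α)))

/-! ### The mesh -/

/-- The elements of a mesh of `ℝ^d`: the `d`-dimensional simplices (given by their vertices). -/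
def elements {d : ℕ} (K : Geometry.SimplicialComplex ℝ (Space d)) : Set (Finset (Space d)) :=
  {t | t ∈ K.faces ∧ t.card = d + 1}

/-- The diameter of a simplex. -/
noncomputable def simplexDiam {d : ℕ} (t : Finset (Space d)) : ℝ :=
  Metric.diam (convexHull ℝ (t : Set (Space d)))

/-- The mesh size `h`, the largest diameter of an element. -/
noncomputable def meshSize {d : ℕ} (K : Geometry.SimplicialComplex ℝ (Space d)) : ℝ :=
  sSup (simplexDiam '' elements K)

/-- The nodes on the boundary of the computational domain `K.space`. -/
def boundaryNodes {d : ℕ} (K : Geometry.SimplicialComplex ℝ (Space d)) : Set (Space d) :=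
  K.vertices ∩ frontier K.space

/-- The remaining nodes. -/
def interiorNodes {d : ℕ} (K : Geometry.SimplicialComplex ℝ (Space d)) : Set (Space d) :=
  K.vertices \ boundaryNodes K

/-- `K` is a conforming simplicial mesh (the union of its finitely many `d`-simplices), with shape
regularity constant `σ` and quasi-uniformity constant `κ`, whose computational domain
`K.space` is convex and whose boundary nodes lie on `∂Ω`. (Consequently
`K.space ⊆ closure Ω`.) -/
structure IsMesh {d : ℕ} (Ω : Set (Space d)) (σ κ : ℝ)
    (K : Geometry.SimplicialComplex ℝ (Space d)) : Prop where
  finite : K.faces.Finite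
  pure : ∀ s ∈ K.faces, ∃ t ∈ elements K, s ⊆ t
  /-- every element `T` contains a ball of diameter `2 r` with `diam T ≤ σ (2 r)` -/
  shapeRegular : ∀ t ∈ elements K, ∃ (c : Space d) (r : ℝ), 0 < r ∧
    Metric.closedBall c r ⊆ convexHull ℝ (t : Set (Space d)) ∧ simplexDiam t ≤ σ * (2 * r)
  quasiUniform : ∀ t ∈ elements K, meshSize K ≤ κ * simplexDiam t
  convex_space : Convex ℝ K.space
  boundaryNodes_subset : boundaryNodes K ⊆ frontier Ω

/-- `w` (restricted to `K.space`) belongs to the space `V_h` of continuous functions that are affine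
on every element. -/
structure IsPiecewiseLinear {d : ℕ} (K : Geometry.SimplicialComplex ℝ (Space d))
    (w : Space d → ℝ) : Prop where
  continuousOn : ContinuousOn w K.space
  affine_on : ∀ t ∈ elements K, ∃ A : Space d →ᵃ[ℝ] ℝ,
    Set.EqOn w A (convexHull ℝ (t : Set (Space d)))

/-! ### The discrete operator -/

/-- The finite set `S_θ` of unit vectors (`dirs`) and the finite set `S_θ^⊥` of orthonormal bases
(`bases`) that approximate the unit sphere and the set of all orthonormal bases of `ℝ^d` up
to `θ`. -/
structure DirectionNet (d : ℕ) (θ : ℝ) where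
  dirs : Finset (Space d)
  norm_dirs : ∀ v ∈ dirs, ‖v‖ = 1
  approx_dirs : ∀ v : Space d, ‖v‖ = 1 → ∃ w ∈ dirs, ‖v - w‖ ≤ θ
  bases : Finset (Fin d → Space d)
  orthonormal_bases : ∀ v ∈ bases, Orthonormal ℝ v
  approx_bases : ∀ v : Fin d → Space d, Orthonormal ℝ v →
    ∃ w ∈ bases, ∀ j, w j ∈ dirs ∧ ‖v j - w j‖ ≤ θ

theorem DirectionNet.bases_nonempty {d : ℕ} {θ : ℝ} (N : DirectionNet d θ) : N.bases.Nonempty := by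
  obtain ⟨w, hw, -⟩ := N.approx_bases _ (EuclideanSpace.basisFun (Fin d) ℝ).orthonormal
  exact ⟨w, hw⟩

/-- The length `δ̂ = ρ δ` with `ρ ∈ (0,1]` maximal such that the ball of radius `δ̂` about the
interior node `x` is contained in the computational domain: the minimum of `δ` and the distance
from `x` to the complement of the computational domain. -/
noncomputable def localScale {d : ℕ} (K : Geometry.SimplicialComplex ℝ (Space d)) (δ : ℝ)
    (x : Space d) : ℝ :=
  min δ (Metric.infDist x K.spaceᶜ)

/-- The centered second difference `(w(x + s v) - 2 w(x) + w(x - s v)) / s²` of step `s`. -/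
noncomputable def secondDiff {d : ℕ} (s : ℝ) (w : Space d → ℝ) (x v : Space d) : ℝ :=
  (w (x + s • v) - 2 * w x + w (x - s • v)) / s ^ 2

/-- The two-scale operator
`T_ε[w](x) = min_{v ∈ S_θ^⊥} (∏_j ∇²⁺w(x;v_j) - ∑_j ∇²⁻w(x;v_j))`, with the positive part
`max(·,0)` and the negative part `-min(·,0)` of the second differences of step `δ̂`. -/
noncomputable def twoScaleOp {d : ℕ} {θ : ℝ} (K : Geometry.SimplicialComplex ℝ (Space d)) (δ : ℝ)
    (N : DirectionNet d θ) (w : Space d → ℝ) (x : Space d) : ℝ :=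
  N.bases.inf' N.bases_nonempty fun v =>
    (∏ j, max (secondDiff (localScale K δ x) w x (v j)) 0) -
      ∑ j, -min (secondDiff (localScale K δ x) w x (v j)) 0

/-- `w` is a discrete solution: `w ∈ V_h`, `w = g` at the boundary nodes and `T_ε[w] = f` at the
interior nodes. -/
structure IsDiscreteSolution {d : ℕ} {θ : ℝ} (K : Geometry.SimplicialComplex ℝ (Space d)) (δ : ℝ)
    (N : DirectionNet d θ) (f g w : Space d → ℝ) : Prop where
  piecewiseLinear : IsPiecewiseLinear K w
  boundary : ∀ x ∈ boundaryNodes K, w x = g x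
  interior : ∀ x ∈ interiorNodes K, twoScaleOp K δ N w x = f x

end TwoScaleMA

open TwoScaleMA

/-!
Write `M = |u|_{W²_∞}`, `H = |u|_{C^{2+k,α}}`, `R = R_k(u)`, `p = 2 + k + α`, `D` for a bound on the
diameter of `Ω`. The scales `δ` and `θ` are chosen such that the three consistency errors balance:
`H δ^{k+α} = M θ²` and `h² / δ² = θ²`, while `M^d θ` is the first term of the claimed bound
(`scale_balance`). The two inequalities are proved by comparing `uε` with `u ± c q`,
`q(y) = |y - x₀|² / 2`, at a node where the difference is extremal. No interpolant has to be
formed: a continuous piecewise affine function is at every point the average, with barycentric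
weights, of its nodal values, so that an inequality at the nodes passes to second differences
at an extremal node (`le_of_le_at_nodes`, `secondDiff_le_of_max`).

*Lower bound for `uε`* (`Setting.sub_le`). For convex `v` the interpolant lies above `v`, so that
interpolation does not decrease second differences at nodes. By Taylor's formula
(`abs_secondDiff_sub_le`) the second difference of `u` with any step `δ̂ ≤ δ` is at least
`D²u(w, w) - M θ²`, and it is nonnegative. If `u + c q - uε` with `c = 2 M min(θ², 1)` were maximal
at an interior node, then all second differences of `uε` there would exceed `D²u(w, w)`, and
Hadamard's inequality `det A ≤ ∏ ⟨A w_j, w_j⟩` for orthonormal bases (`prod_eigenvalues_le`) would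
give `T_ε[uε] > det D²u = f`. This works up to the boundary.

*Upper bound for `uε`*. Since `f > 0`, `uε` lies below each affine function that lies above `u` at the
boundary nodes. At a boundary point `z`, the tangent plane of `u` can be corrected by a multiple of
the distance to the tangent plane of the enclosing sphere, because `|y - z|²` is bounded by that
multiple on `Ω`; hence `uε(x) ≤ u(x) + M R₀ |x - z|` with the radius `R₀` of the enclosing balls
(`Setting.le_add_dist`). This settles nodes closer than `δ` to the boundary of the computational
domain, which have a boundary node within `δ + h`. At the other nodes the step is `δ`, the
interpolation error of `u` is at most `M h² / 2`, and an orthonormal eigenbasis of `D²u` is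
approximated by an admissible basis with an error `M θ²` in the second derivatives, since
the first order terms have a favourable sign (`apply_self_le_of_norm_sub_le`). A maximum of
`uε - (u - c q)` with `c = 4 M θ²` at such a node would give `T_ε[uε] < f` (`Setting.le_add`).

The resulting bounds are of order `M θ²` and `M (δ + h + h²)`. For `θ ≤ 1` one has `θ² ≤ θ`; for
`θ ≥ 1` the bound `M R₀ D` of the affine barrier is enough. Finally `f₀ ≤ det D²u ≤ M^d` turns
`M θ` into a multiple of `M^d θ`.
-/

namespace TwoScaleMA

variable {d : ℕ}

/-! ### Linear algebra of the Hessian -/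

/-- Spectral theorem for a symmetric bilinear form, together with the determinant of its matrix
in the standard basis. -/
theorem exists_eigenbasis (L : Space d →L[ℝ] Space d →L[ℝ] ℝ) (hL : ∀ x y, L x y = L y x) :
    ∃ (b : OrthonormalBasis (Fin d) ℝ (Space d)) (lam : Fin d → ℝ),
      (∀ i x, L x (b i) = lam i * inner ℝ (b i) x) ∧
      (Matrix.of fun i j =>
        L (EuclideanSpace.single i 1) (EuclideanSpace.single j 1)).det = ∏ i, lam i := by
  set A : Matrix (Fin d) (Fin d) ℝ :=
    Matrix.of fun i j => L (EuclideanSpace.single i 1) (EuclideanSpace.single j 1) with hAdef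
  have hA : A.IsHermitian := by
    ext i j
    simp [hAdef, hL (EuclideanSpace.single j 1)]
  refine ⟨hA.eigenvectorBasis, hA.eigenvalues, fun i x => ?_, by
    simpa using hA.det_eq_prod_eigenvalues⟩
  have hsum : ∀ z : Space d, z = ∑ i, z i • EuclideanSpace.single i (1 : ℝ) := fun z => by
    simpa using ((EuclideanSpace.basisFun (Fin d) ℝ).sum_repr z).symm
  have hbil : ∀ y : Space d, L x y = ∑ i, x i * (A.mulVec y) i := by
    intro y
    conv_lhs => rw [hsum x, hsum y]
    simp only [map_sum, map_smul, _root_.sum_apply, _root_.smul_apply,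
      smul_eq_mul, Matrix.mulVec, dotProduct, hAdef, Matrix.of_apply, Finset.mul_sum]
    rw [Finset.sum_comm]
    exact Finset.sum_congr rfl fun i _ => Finset.sum_congr rfl fun j _ => by ring
  rw [hbil, hA.mulVec_eigenvectorBasis]
  simp only [Pi.smul_apply, smul_eq_mul, PiLp.inner_apply, RCLike.inner_apply, conj_trivial,
    Finset.mul_sum]
  exact Finset.sum_congr rfl fun i _ => by ring

theorem apply_self_eq_sum_eigenvalues {L : Space d →L[ℝ] Space d →L[ℝ] ℝ}
    {b : OrthonormalBasis (Fin d) ℝ (Space d)} {lam : Fin d → ℝ}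
    (hb : ∀ i x, L x (b i) = lam i * inner ℝ (b i) x) (x : Space d) :
    L x x = ∑ i, inner ℝ (b i) x ^ 2 * lam i := by
  conv_lhs => rw [← b.sum_repr' x, map_sum]
  rw [b.sum_repr']
  exact Finset.sum_congr rfl fun i _ => by rw [map_smul, hb, smul_eq_mul]; ring

theorem sum_sq_inner_orthonormal {w : Fin d → Space d} (hw : Orthonormal ℝ w) (x : Space d) :
    ∑ j, inner ℝ x (w j) ^ 2 = ‖x‖ ^ 2 := by
  have hspan : ⊤ ≤ Submodule.span ℝ (Set.range w) :=
    (hw.linearIndependent.span_eq_top_of_card_eq_finrank' (by simp)).ge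
  have h := (OrthonormalBasis.mk hw hspan).sum_sq_norm_inner_left x
  simpa using h

/-- Hadamard's inequality: the determinant of a positive semidefinite form with eigenvalues `lam` is
at most the product of its diagonal entries in any orthonormal basis. The squares of the
inner products of two orthonormal bases form a doubly stochastic matrix, so this is the weighted
inequality of arithmetic and geometric means. -/
theorem prod_eigenvalues_le {lam : Fin d → ℝ} (hlam : ∀ i, 0 ≤ lam i)
    (b : OrthonormalBasis (Fin d) ℝ (Space d)) {w : Fin d → Space d} (hw : Orthonormal ℝ w) :
    ∏ i, lam i ≤ ∏ j, ∑ i, inner ℝ (b i) (w j) ^ 2 * lam i := by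
  calc ∏ i, lam i = ∏ i, lam i ^ (∑ j, inner ℝ (b i) (w j) ^ 2) := by
        refine Finset.prod_congr rfl fun i _ => ?_
        rw [sum_sq_inner_orthonormal hw, b.norm_eq_one]; simp
    _ = ∏ i, ∏ j, lam i ^ (inner ℝ (b i) (w j) ^ 2) :=
        Finset.prod_congr rfl fun i _ =>
          Real.rpow_sum_of_nonneg (hlam i) fun j _ => sq_nonneg _
    _ = ∏ j, ∏ i, lam i ^ (inner ℝ (b i) (w j) ^ 2) := Finset.prod_comm
    _ ≤ _ := by
        refine Finset.prod_le_prod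
          (fun j _ => Finset.prod_nonneg fun i _ => Real.rpow_nonneg (hlam i) _) fun j _ => ?_
        refine Real.geom_mean_le_arith_mean_weighted _ _ _ (fun i _ => sq_nonneg _) ?_
          fun i _ => hlam i
        have := b.sum_sq_norm_inner_right (w j)
        simpa [hw.1 j] using this

/-- A unit vector `θ`-close to a unit eigenvector has a Rayleigh quotient that exceeds the eigenvalue
only by `O(θ²)`: the first order term `2 l ⟨v, w - v⟩` is nonpositive for unit vectors. -/
theorem apply_self_le_of_norm_sub_le {L : Space d →L[ℝ] Space d →L[ℝ] ℝ}
    (hL : ∀ x y, L x y = L y x) {v w : Space d} (hv : ‖v‖ = 1) (hw : ‖w‖ = 1) {l M θ : ℝ}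
    (hl : 0 ≤ l) (hM : ∀ x, L x x ≤ M * ‖x‖ ^ 2) (hM0 : 0 ≤ M)
    (hv' : ∀ x, L x v = l * inner ℝ v x) (hθ : ‖v - w‖ ≤ θ) :
    L w w ≤ l + M * θ ^ 2 := by
  have h1 : L w w = L v v + 2 * L (w - v) v + L (w - v) (w - v) := by
    have := hL v w
    simp only [map_sub, _root_.sub_apply]
    linarith
  have h2 : inner ℝ v (w - v) ≤ 0 := by
    rw [inner_sub_right, real_inner_self_eq_norm_sq, hv]
    have := real_inner_le_norm v w
    rw [hv, hw] at this
    linarith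
  have h3 : L (w - v) (w - v) ≤ M * θ ^ 2 := by
    refine (hM _).trans ?_
    rw [norm_sub_rev]
    gcongr
  have h4 : L v v = l := by rw [hv', real_inner_self_eq_norm_sq, hv]; ring
  have h5 := hv' (w - v)
  nlinarith [mul_nonpos_of_nonneg_of_nonpos hl h2]

/-! ### Directional derivatives and Taylor's formula -/

/-- Taylor's formula of order two as an upper bound; at the right end point only continuity is
needed, so that segments may end on the boundary of a domain. -/
theorem le_taylor_two {φ φ' φ'' : ℝ → ℝ} {s b : ℝ} (hs : 0 ≤ s)
    (hc : ContinuousOn φ (Set.Icc 0 s)) (h1 : ∀ t ∈ Set.Ico 0 s, HasDerivAt φ (φ' t) t)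
    (h2 : ∀ t ∈ Set.Ico 0 s, HasDerivAt φ' (φ'' t) t) (hb : ∀ t ∈ Set.Ico 0 s, φ'' t ≤ b) :
    φ s ≤ φ 0 + φ' 0 * s + b / 2 * s ^ 2 := by
  have hφ' : ∀ t ∈ Set.Ico 0 s, φ' t ≤ φ' 0 + b * t := by
    intro t ht
    have hsub : ∀ x ∈ Set.Icc 0 t, x ∈ Set.Ico 0 s := fun x hx => ⟨hx.1, hx.2.trans_lt ht.2⟩
    refine image_le_of_deriv_right_le_deriv_boundary (f' := φ'') (B' := fun _ => b)
      (B := fun t => φ' 0 + b * t)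
      (fun x hx => (h2 x (hsub x hx)).continuousAt.continuousWithinAt)
      (fun x hx => (h2 x (hsub x (Set.Ico_subset_Icc_self hx))).hasDerivWithinAt) (by simp)
      (by fun_prop) (fun x _ => ?_) (fun x hx => hb x (hsub x (Set.Ico_subset_Icc_self hx)))
      ⟨ht.1, le_rfl⟩
    simpa using (((hasDerivAt_id x).const_mul b).const_add (φ' 0)).hasDerivWithinAt
  refine image_le_of_deriv_right_le_deriv_boundary (f' := φ') (B' := fun t => φ' 0 + b * t)
      (B := fun t => φ 0 + φ' 0 * t + b / 2 * t ^ 2) hc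
      (fun x hx => (h1 x hx).hasDerivWithinAt) (by simp)
      (by fun_prop) (fun x _ => ?_) hφ' ⟨hs, le_rfl⟩
  have := ((((hasDerivAt_id x).const_mul (φ' 0)).const_add (φ 0)).add
    (((hasDerivAt_id x).pow 2).const_mul (b / 2))).hasDerivWithinAt (s := Set.Ici x)
  convert! this using 1
  simp; ring

theorem taylor_two_le {φ φ' φ'' : ℝ → ℝ} {s b : ℝ} (hs : 0 ≤ s)
    (hc : ContinuousOn φ (Set.Icc 0 s)) (h1 : ∀ t ∈ Set.Ico 0 s, HasDerivAt φ (φ' t) t)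
    (h2 : ∀ t ∈ Set.Ico 0 s, HasDerivAt φ' (φ'' t) t) (hb : ∀ t ∈ Set.Ico 0 s, b ≤ φ'' t) :
    φ 0 + φ' 0 * s + b / 2 * s ^ 2 ≤ φ s := by
  have := le_taylor_two (φ := -φ) (φ' := -φ') (φ'' := -φ'') (b := -b) hs hc.neg
    (fun t ht => (h1 t ht).neg) (fun t ht => (h2 t ht).neg) (fun t ht => neg_le_neg (hb t ht))
  simp only [Pi.neg_apply] at this
  linarith

/-- The `n`-th derivative of `u` at `x` in the direction `w`. -/
noncomputable def dirDeriv (n : ℕ) (u : Space d → ℝ) (x w : Space d) : ℝ :=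
  iteratedFDeriv ℝ n u x fun _ => w

theorem hasDerivAt_dirDeriv {n : ℕ} {u : Space d → ℝ} {x w : Space d} {t : ℝ}
    (hu : ContDiffAt ℝ (n + 1 : ℕ) u (x + t • w)) :
    HasDerivAt (fun t => dirDeriv n u (x + t • w) w) (dirDeriv (n + 1) u (x + t • w) w) t := by
  have hd : DifferentiableAt ℝ (iteratedFDeriv ℝ n u) (x + t • w) :=
    hu.differentiableAt_iteratedFDeriv (by exact_mod_cast n.lt_succ_self)
  have hl : HasDerivAt (fun t : ℝ => x + t • w) w t := by
    simpa using ((hasDerivAt_id t).smul_const w).const_add x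
  have h1 := hd.hasFDerivAt.comp_hasDerivAt t hl
  have h2 := ((ContinuousMultilinearMap.apply ℝ (fun _ : Fin n => Space d) ℝ
    (fun _ => w)).hasFDerivAt.comp_hasDerivAt t h1)
  exact h2

theorem dirDeriv_zero (u : Space d → ℝ) (x w : Space d) : dirDeriv 0 u x w = u x := by
  simp [dirDeriv]

theorem dirDeriv_smul (n : ℕ) (u : Space d → ℝ) (x w : Space d) (c : ℝ) :
    dirDeriv n u x (c • w) = c ^ n * dirDeriv n u x w := by
  have := (iteratedFDeriv ℝ n u x).map_smul_univ (fun _ => c) (fun _ => w)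
  simpa [dirDeriv] using this

theorem dirDeriv_neg (n : ℕ) (u : Space d → ℝ) (x w : Space d) :
    dirDeriv n u x (-w) = (-1) ^ n * dirDeriv n u x w := by
  rw [← dirDeriv_smul]; simp

theorem dirDeriv_two (u : Space d → ℝ) (x w : Space d) :
    dirDeriv 2 u x w = fderiv ℝ (fderiv ℝ u) x w w := by
  rw [dirDeriv, iteratedFDeriv_two_apply]

theorem abs_dirDeriv_sub_le {n : ℕ} {u : Space d → ℝ} {x y w : Space d} {c : ℝ} (hw : ‖w‖ = 1)
    (h : ‖iteratedFDeriv ℝ n u x - iteratedFDeriv ℝ n u y‖ ≤ c) :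
    |dirDeriv n u x w - dirDeriv n u y w| ≤ c := by
  refine le_trans ?_ h
  have := (iteratedFDeriv ℝ n u x - iteratedFDeriv ℝ n u y).le_opNorm (fun _ => w)
  simpa [hw, dirDeriv] using this

theorem abs_dirDeriv_le (n : ℕ) (u : Space d → ℝ) (x w : Space d) :
    |dirDeriv n u x w| ≤ ‖iteratedFDeriv ℝ n u x‖ * ‖w‖ ^ n := by
  have := (iteratedFDeriv ℝ n u x).le_opNorm (fun _ => w)
  simpa [dirDeriv] using this

section Regularity

variable {Ω : Set (Space d)} {u : Space d → ℝ} {m k : ℕ} {α : ℝ}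

theorem IsHolderClass.norm_sub_le (hu : IsHolderClass m α Ω u) {x y : Space d} (hα : 0 < α)
    (hx : x ∈ Ω) (hy : y ∈ Ω) :
    ‖iteratedFDeriv ℝ m u x - iteratedFDeriv ℝ m u y‖ ≤ holderSeminorm m α Ω u * ‖x - y‖ ^ α := by
  rcases eq_or_ne x y with rfl | hxy
  · simp [Real.zero_rpow hα.ne']
  obtain ⟨K, hK⟩ := hu.holder
  have hpos : ∀ {x y : Space d}, x ≠ y → 0 < ‖x - y‖ ^ α := fun h =>
    Real.rpow_pos_of_pos (norm_pos_iff.2 (sub_ne_zero.2 h)) _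
  rw [← div_le_iff₀ (hpos hxy)]
  refine le_csSup ⟨K, ?_⟩ ⟨x, hx, y, hy, hxy, rfl⟩
  rintro _ ⟨x, hx, y, hy, hxy, rfl⟩
  exact (div_le_iff₀ (hpos hxy)).2 (hK x hx y hy)

theorem IsHolderClass.norm_le_w2Inf (hu : IsHolderClass m α Ω u) (hm : 2 ≤ m)
    (hΩ : Bornology.IsBounded Ω) {x : Space d} (hx : x ∈ Ω) :
    ‖iteratedFDeriv ℝ 2 u x‖ ≤ w2InfSeminorm Ω u := by
  obtain ⟨F, hF, hFe⟩ := hu.extends_closure 2 hm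
  obtain ⟨B, hB⟩ := hΩ.isCompact_closure.exists_bound_of_continuousOn hF
  refine le_csSup ⟨B, ?_⟩ ⟨x, hx, rfl⟩
  rintro _ ⟨y, hy, rfl⟩
  rw [← hFe hy]
  exact hB y (subset_closure hy)

theorem IsHolderClass.contDiffAt (hu : IsHolderClass m α Ω u) (hΩ : IsOpen Ω) {x : Space d}
    (hx : x ∈ Ω) {n : ℕ} (hn : n ≤ m) : ContDiffAt ℝ n u x :=
  (hu.contDiffOn.contDiffAt (hΩ.mem_nhds hx)).of_le (by exact_mod_cast hn)

/-- Hölder continuity of `D^{2+k} u` for the symmetrized second derivative. For `k = 1` the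
first order variations at `x + t w` and `x - t w` cancel up to a difference of third derivatives. -/
theorem abs_symm_dirDeriv_two_le (hk : k = 0 ∨ k = 1) (hα : 0 < α) (hα1 : α ≤ 1)
    (hΩ : IsOpen Ω) (hu : IsHolderClass (2 + k) α Ω u) {x w : Space d} (hw : ‖w‖ = 1) {s t : ℝ}
    (ht : 0 ≤ t) (hts : t ≤ s) (hp : ∀ t' ∈ Set.Icc 0 t, x + t' • w ∈ Ω)
    (hn : ∀ t' ∈ Set.Icc 0 t, x + t' • (-w) ∈ Ω) :
    |dirDeriv 2 u (x + t • w) w + dirDeriv 2 u (x + t • (-w)) (-w) - 2 * dirDeriv 2 u x w| ≤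
      2 * (holderSeminorm (2 + k) α Ω u * s ^ (k + α)) := by
  have hxΩ : x ∈ Ω := by simpa using hp 0 ⟨le_rfl, ht⟩
  have hH0 : 0 ≤ holderSeminorm (2 + k) α Ω u := by
    refine Real.sSup_nonneg ?_
    rintro _ ⟨a, -, b, -, -, rfl⟩
    positivity
  rcases hk with rfl | rfl
  · rw [dirDeriv_neg]
    have key : ∀ c : Space d, ‖c‖ = t → x + c ∈ Ω →
        |dirDeriv 2 u (x + c) w - dirDeriv 2 u x w| ≤ holderSeminorm 2 α Ω u * s ^ α := by
      intro c hc hcΩ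
      refine abs_dirDeriv_sub_le hw ((hu.norm_sub_le hα hcΩ hxΩ).trans ?_)
      simp only [Nat.add_zero, add_sub_cancel_left, hc]
      gcongr
    have h1 := key (t • w) (by simp [norm_smul, hw, abs_of_nonneg ht]) (hp t ⟨ht, le_rfl⟩)
    have h2 := key (t • -w) (by simp [norm_smul, hw, abs_of_nonneg ht]) (hn t ⟨ht, le_rfl⟩)
    simp only [Nat.cast_zero, zero_add]
    rw [neg_one_sq, one_mul]
    rw [abs_le] at h1 h2 ⊢
    constructor <;> linarith [h1.1, h1.2, h2.1, h2.2]
  · have hs0 : 0 ≤ s := ht.trans hts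
    have hd : ∀ t' ∈ Set.Icc 0 t, HasDerivAt
        (fun t => dirDeriv 2 u (x + t • w) w + dirDeriv 2 u (x + t • (-w)) (-w))
        (dirDeriv 3 u (x + t' • w) w + dirDeriv 3 u (x + t' • (-w)) (-w)) t' := fun t' h =>
      (hasDerivAt_dirDeriv (hu.contDiffAt hΩ (hp t' h) (by norm_num))).add
        (hasDerivAt_dirDeriv (hu.contDiffAt hΩ (hn t' h) (by norm_num)))
    have hb : ∀ t' ∈ Set.Ico 0 t,
        ‖dirDeriv 3 u (x + t' • w) w + dirDeriv 3 u (x + t' • (-w)) (-w)‖ ≤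
          2 * (holderSeminorm 3 α Ω u * s ^ α) := by
      intro t' h
      have h' := Set.Ico_subset_Icc_self h
      have hle := abs_dirDeriv_sub_le hw (hu.norm_sub_le hα (hp t' h') (hn t' h'))
      have hnorm : ‖x + t' • w - (x + t' • -w)‖ = 2 * t' := by
        rw [show x + t' • w - (x + t' • -w) = (2 * t') • w by module, norm_smul, hw]
        simp [abs_of_nonneg h.1]
      rw [hnorm] at hle
      have h2 : (2 * t') ^ α ≤ 2 * s ^ α := by
        rw [Real.mul_rpow (by norm_num) h.1]
        have h21 : (2 : ℝ) ^ α ≤ 2 := by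
          simpa using Real.rpow_le_rpow_of_exponent_le (x := 2) (by norm_num) hα1
        have : t' ^ α ≤ s ^ α := Real.rpow_le_rpow h.1 (h.2.le.trans hts) hα.le
        have : 0 ≤ t' ^ α := Real.rpow_nonneg h.1 _
        gcongr
      rw [dirDeriv_neg, Real.norm_eq_abs, show (-1 : ℝ) ^ 3 = -1 by norm_num, neg_one_mul,
        ← sub_eq_add_neg]
      refine hle.trans ?_
      have := mul_le_mul_of_nonneg_left h2 hH0
      linarith
    have := norm_image_sub_le_of_norm_deriv_le_segment' (fun t' h => (hd t' h).hasDerivWithinAt) hb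
      t ⟨ht, le_rfl⟩
    simp only [zero_smul, add_zero, dirDeriv_neg 2 u x w, Real.norm_eq_abs, sub_zero] at this
    rw [show dirDeriv 2 u x w + (-1) ^ 2 * dirDeriv 2 u x w = 2 * dirDeriv 2 u x w by ring] at this
    refine this.trans ?_
    rw [Nat.cast_one, Real.rpow_add' hs0 (by positivity), Real.rpow_one]
    have : 0 ≤ holderSeminorm 3 α Ω u * s ^ α := mul_nonneg hH0 (Real.rpow_nonneg hs0 _)
    norm_num
    nlinarith

/-- Consistency of the centered second difference. The ball of radius `s` is open: the end points
`x ± s w` may lie on the boundary of `Ω`. -/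
theorem abs_secondDiff_sub_le (hk : k = 0 ∨ k = 1) (hα : 0 < α) (hα1 : α ≤ 1)
    (hΩ : IsOpen Ω) (hu : IsHolderClass (2 + k) α Ω u) {x w : Space d} (hw : ‖w‖ = 1) {s : ℝ}
    (hs : 0 < s) (hball : Metric.ball x s ⊆ Ω) :
    |secondDiff s u x w - dirDeriv 2 u x w| ≤ holderSeminorm (2 + k) α Ω u * s ^ (k + α) := by
  have hmem : ∀ c : Space d, ‖c‖ = 1 → ∀ t ∈ Set.Ico 0 s, x + t • c ∈ Ω := fun c hc t ht =>
    hball (by simpa [norm_smul, hc, abs_of_nonneg ht.1] using ht.2)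
  have hmem' : ∀ c : Space d, ‖c‖ = 1 → ∀ t ∈ Set.Icc 0 s, x + t • c ∈ closure Ω := by
    intro c hc t ht
    refine closure_mono hball ?_
    rw [closure_ball x hs.ne']
    simpa [norm_smul, hc, abs_of_nonneg ht.1] using ht.2
  have hnw : ‖-w‖ = 1 := by rwa [norm_neg]
  have hcont : ∀ c : Space d, ‖c‖ = 1 →
      ContinuousOn (fun t : ℝ => dirDeriv 0 u (x + t • c) c) (Set.Icc 0 s) := by
    intro c hc
    simp only [dirDeriv_zero]
    exact hu.continuousOn.comp (by fun_prop) fun t ht => hmem' c hc t ht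
  have hder : ∀ n ≤ 1, ∀ t ∈ Set.Ico 0 s, HasDerivAt
        (fun t => dirDeriv n u (x + t • w) w + dirDeriv n u (x + t • (-w)) (-w))
        (dirDeriv (n + 1) u (x + t • w) w + dirDeriv (n + 1) u (x + t • (-w)) (-w)) t :=
    fun n hn t ht =>
      (hasDerivAt_dirDeriv (hu.contDiffAt hΩ (hmem w hw t ht) (by omega))).add
        (hasDerivAt_dirDeriv (hu.contDiffAt hΩ (hmem _ hnw t ht) (by omega)))
  have hb : ∀ t ∈ Set.Ico 0 s, _ := fun t ht => abs_le.1 <| abs_symm_dirDeriv_two_le hk hα hα1 hΩ hu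
    hw ht.1 ht.2.le (fun t' h => hmem w hw t' ⟨h.1, h.2.trans_lt ht.2⟩)
    (fun t' h => hmem _ hnw t' ⟨h.1, h.2.trans_lt ht.2⟩)
  have hup := le_taylor_two hs.le ((hcont w hw).add (hcont _ hnw)) (hder 0 (by norm_num))
    (hder 1 le_rfl) (fun t ht => sub_le_iff_le_add.1 (hb t ht).2)
  have hlo := taylor_two_le hs.le ((hcont w hw).add (hcont _ hnw)) (hder 0 (by norm_num))
    (hder 1 le_rfl) (fun t ht => le_sub_iff_add_le.1 (hb t ht).1)
  simp only [Pi.add_apply, dirDeriv_zero, zero_smul, add_zero, zero_add, dirDeriv_neg 1 u x w]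
    at hup hlo
  have hs2 : 0 < s ^ 2 := by positivity
  rw [secondDiff, show x - s • w = x + s • (-w) by module, abs_le]
  constructor
  · rw [le_sub_iff_add_le, le_div_iff₀ hs2]; linarith
  · rw [sub_le_iff_le_add, div_le_iff₀ hs2]; linarith

end Regularity

/-! ### Convex solutions -/

section Solution

variable {Ω : Set (Space d)} {f g u : Space d → ℝ} {k : ℕ} {α : ℝ}

theorem secondDiff_nonneg {S : Set (Space d)} (hu : ConvexOn ℝ S u) {x w : Space d} {s : ℝ}
    (h1 : x + s • w ∈ S) (h2 : x - s • w ∈ S) : 0 ≤ secondDiff s u x w := by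
  have := hu.2 h1 h2 (by norm_num : (0 : ℝ) ≤ 1 / 2) (by norm_num : (0 : ℝ) ≤ 1 / 2) (by norm_num)
  rw [show (1 / 2 : ℝ) • (x + s • w) + (1 / 2 : ℝ) • (x - s • w) = x by module] at this
  simp only [smul_eq_mul] at this
  exact div_nonneg (by linarith) (sq_nonneg s)

theorem dirDeriv_two_nonneg (hk : k = 0 ∨ k = 1) (hα : 0 < α) (hα1 : α ≤ 1) (hΩ : IsOpen Ω)
    (hu : IsHolderClass (2 + k) α Ω u) (hc : ConvexOn ℝ (closure Ω) u) {x : Space d} (hx : x ∈ Ω)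
    (w : Space d) : 0 ≤ dirDeriv 2 u x w := by
  have unit : ∀ w : Space d, ‖w‖ = 1 → 0 ≤ dirDeriv 2 u x w := by
    intro w hw
    obtain ⟨r, hr, hrΩ⟩ := Metric.isOpen_iff.1 hΩ x hx
    have hlim : Filter.Tendsto (fun s : ℝ => holderSeminorm (2 + k) α Ω u * s ^ (k + α))
        (nhdsWithin 0 (Set.Ioi 0)) (nhds 0) := by
      have hpos : 0 < (k : ℝ) + α := by positivity
      have := (Real.continuousAt_rpow_const 0 (k + α) (Or.inr hpos.le)).tendsto.const_mul
        (holderSeminorm (2 + k) α Ω u)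
      rw [Real.zero_rpow hpos.ne', mul_zero] at this
      exact this.mono_left nhdsWithin_le_nhds
    rw [← neg_nonpos]
    refine ge_of_tendsto hlim ?_
    filter_upwards [Ioo_mem_nhdsGT hr] with s hs
    have hball : Metric.ball x s ⊆ Ω := (Metric.ball_subset_ball hs.2.le).trans hrΩ
    have h1 := abs_secondDiff_sub_le hk hα hα1 hΩ hu hw hs.1 hball
    have h2 : 0 ≤ secondDiff s u x w := by
      refine secondDiff_nonneg hc (subset_closure (hrΩ ?_)) (subset_closure (hrΩ ?_)) <;>
      simpa [norm_smul, hw, abs_of_pos hs.1] using hs.2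
    linarith [(abs_le.1 h1).2]
  rcases eq_or_ne w 0 with rfl | hw
  · simpa using (dirDeriv_smul 2 u x 0 0).ge
  · have h := unit (‖w‖⁻¹ • w) (norm_smul_inv_norm hw)
    have h2 := dirDeriv_smul 2 u x (‖w‖⁻¹ • w) ‖w‖
    rw [smul_inv_smul₀ (norm_ne_zero_iff.2 hw)] at h2
    rw [h2]
    positivity

/-- The Hessian of the solution as a bilinear form `L`, with an orthonormal eigenbasis, nonnegative
eigenvalues, and their product given by the equation. -/
theorem exists_spectral (hk : k = 0 ∨ k = 1) (hα : 0 < α) (hα1 : α ≤ 1) (hΩ : IsOpen Ω)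
    (hu : IsHolderClass (2 + k) α Ω u) (hs : IsConvexSolution Ω f g u) {x : Space d} (hx : x ∈ Ω) :
    ∃ (L : Space d →L[ℝ] Space d →L[ℝ] ℝ) (b : OrthonormalBasis (Fin d) ℝ (Space d))
      (lam : Fin d → ℝ), (∀ y z, L y z = L z y) ∧ (∀ w, dirDeriv 2 u x w = L w w) ∧
      (∀ i y, L y (b i) = lam i * inner ℝ (b i) y) ∧ (∀ i, 0 ≤ lam i) ∧ ∏ i, lam i = f x := by
  have hsymm : IsSymmSndFDerivAt ℝ u x :=
    (hu.contDiffAt hΩ hx (n := 2) (by omega)).isSymmSndFDerivAt (by simp)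
  obtain ⟨b, lam, hb, hdet⟩ := exists_eigenbasis (fderiv ℝ (fderiv ℝ u) x) hsymm
  refine ⟨_, b, lam, hsymm, fun w => dirDeriv_two u x w, hb, fun i => ?_, ?_⟩
  · have h := dirDeriv_two_nonneg hk hα hα1 hΩ hu hs.convexOn hx (b i)
    rwa [dirDeriv_two, hb, real_inner_self_eq_norm_sq, b.norm_eq_one, one_pow, mul_one] at h
  · rw [← hdet, ← hs.det_eq x hx, hessian]
    congr 1
    ext i j
    simp [iteratedFDeriv_two_apply]

theorem w2InfSeminorm_nonneg : 0 ≤ w2InfSeminorm Ω u := by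
  refine Real.sSup_nonneg ?_
  rintro _ ⟨x, -, rfl⟩
  exact norm_nonneg _

theorem dirDeriv_two_le (hu : IsHolderClass (2 + k) α Ω u) (hΩb : Bornology.IsBounded Ω)
    {x : Space d} (hx : x ∈ Ω) (w : Space d) :
    dirDeriv 2 u x w ≤ w2InfSeminorm Ω u * ‖w‖ ^ 2 :=
  (le_abs_self _).trans <| (abs_dirDeriv_le 2 u x w).trans <|
    mul_le_mul_of_nonneg_right (hu.norm_le_w2Inf (by omega) hΩb hx) (by positivity)

theorem le_w2InfSeminorm_pow (hk : k = 0 ∨ k = 1) (hα : 0 < α) (hα1 : α ≤ 1) (hΩ : IsOpen Ω)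
    (hΩb : Bornology.IsBounded Ω) (hu : IsHolderClass (2 + k) α Ω u)
    (hs : IsConvexSolution Ω f g u) {x : Space d} (hx : x ∈ Ω) :
    f x ≤ w2InfSeminorm Ω u ^ d := by
  obtain ⟨L, b, lam, -, hL, hb, hlam, hdet⟩ := exists_spectral hk hα hα1 hΩ hu hs hx
  rw [← hdet]
  refine (Finset.prod_le_prod (fun i _ => hlam i) (g := fun _ => w2InfSeminorm Ω u)
    fun i _ => ?_).trans_eq (by simp)
  have h := dirDeriv_two_le hu hΩb hx (b i)
  rwa [hL, hb, real_inner_self_eq_norm_sq, b.norm_eq_one, one_pow, mul_one, mul_one] at h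

theorem tangent_bounds (hk : k = 0 ∨ k = 1) (hα : 0 < α) (hα1 : α ≤ 1) (hΩ : IsOpen Ω)
    (hΩb : Bornology.IsBounded Ω) (hΩc : Convex ℝ Ω) (hu : IsHolderClass (2 + k) α Ω u)
    (hc : ConvexOn ℝ (closure Ω) u) {z y : Space d} (hz : z ∈ Ω) (hy : y ∈ closure Ω) :
    u z + fderiv ℝ u z (y - z) ≤ u y ∧
      u y ≤ u z + fderiv ℝ u z (y - z) + w2InfSeminorm Ω u / 2 * ‖y - z‖ ^ 2 := by
  have hmem : ∀ t ∈ Set.Ico (0 : ℝ) 1, z + t • (y - z) ∈ Ω := by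
    intro t ht
    have := hΩc.combo_interior_closure_mem_interior (hΩ.interior_eq.symm ▸ hz) hy
      (sub_pos.2 ht.2) ht.1 (by ring)
    rw [hΩ.interior_eq] at this
    convert this using 1
    module
  have hcont : ContinuousOn (fun t : ℝ => dirDeriv 0 u (z + t • (y - z)) (y - z)) (Set.Icc 0 1) := by
    simp only [dirDeriv_zero]
    refine hu.continuousOn.comp (by fun_prop) fun t ht => ?_
    have := hΩc.closure (subset_closure hz) hy (sub_nonneg.2 ht.2) ht.1 (by ring)
    convert this using 1
    module
  have hder : ∀ n ≤ 1, ∀ t ∈ Set.Ico (0 : ℝ) 1, HasDerivAt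
      (fun t => dirDeriv n u (z + t • (y - z)) (y - z))
      (dirDeriv (n + 1) u (z + t • (y - z)) (y - z)) t :=
    fun n hn t ht => hasDerivAt_dirDeriv (hu.contDiffAt hΩ (hmem t ht) (by omega))
  have hup := le_taylor_two zero_le_one hcont (hder 0 (by norm_num)) (hder 1 le_rfl)
    fun t ht => dirDeriv_two_le hu hΩb (hmem t ht) _
  have hlo := taylor_two_le zero_le_one hcont (hder 0 (by norm_num)) (hder 1 le_rfl)
    fun t ht => dirDeriv_two_nonneg hk hα hα1 hΩ hu hc (hmem t ht) _
  have h1 : dirDeriv 1 u z (y - z) = fderiv ℝ u z (y - z) := by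
    simp [dirDeriv, iteratedFDeriv_one_apply]
  simp only [dirDeriv_zero, zero_smul, add_zero, zero_add, h1, one_smul, add_sub_cancel] at hup hlo
  constructor <;> linarith

/-- At every point `z` of the closure, `u` has an affine minorant which it exceeds by at most
`M |y - z|² / 2 + η`. The tangent plane at an interior point near `z` serves, which avoids
derivatives on the boundary. -/
theorem exists_affine_minorant (hk : k = 0 ∨ k = 1) (hα : 0 < α) (hα1 : α ≤ 1) (hΩ : IsOpen Ω)
    (hΩb : Bornology.IsBounded Ω) (hΩc : Convex ℝ Ω) (hu : IsHolderClass (2 + k) α Ω u)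
    (hc : ConvexOn ℝ (closure Ω) u) {z : Space d} (hz : z ∈ closure Ω) {η : ℝ} (hη : 0 < η) :
    ∃ (L : Space d →L[ℝ] ℝ) (c : ℝ), (∀ y ∈ closure Ω, L y + c ≤ u y) ∧
      ∀ y ∈ closure Ω, u y ≤ L y + c + w2InfSeminorm Ω u / 2 * ‖y - z‖ ^ 2 + η := by
  set M := w2InfSeminorm Ω u
  have hM : 0 ≤ M := w2InfSeminorm_nonneg
  set D := Metric.diam (closure Ω)
  have hD : 0 ≤ D := Metric.diam_nonneg
  set e := min 1 (η / (M * (2 * D + 1) + 1))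
  have hden : 0 < M * (2 * D + 1) + 1 := by positivity
  have he : 0 < e := by positivity
  have he1 : e ≤ 1 := min_le_left _ _
  have he2 : e * (M * (2 * D + 1) + 1) ≤ η := by
    rw [← le_div_iff₀ hden]; exact min_le_right _ _
  obtain ⟨z', hz', hzz'⟩ := Metric.mem_closure_iff.1 hz e he
  refine ⟨fderiv ℝ u z', u z' - fderiv ℝ u z' z', fun y hy => ?_, fun y hy => ?_⟩
  · have := (tangent_bounds hk hα hα1 hΩ hΩb hΩc hu hc hz' hy).1
    rw [map_sub] at this
    linarith
  · have h1 := (tangent_bounds hk hα hα1 hΩ hΩb hΩc hu hc hz' hy).2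
    rw [map_sub] at h1
    have h2 : ‖y - z‖ ≤ D := by
      rw [← dist_eq_norm]; exact Metric.dist_le_diam_of_mem hΩb.closure hy hz
    have h3 : ‖y - z'‖ ≤ ‖y - z‖ + e := by
      refine (norm_sub_le_norm_sub_add_norm_sub y z z').trans ?_
      rw [← dist_eq_norm z z']
      gcongr
    have h4 : ‖y - z'‖ ^ 2 ≤ ‖y - z‖ ^ 2 + e * (2 * D + 1) := by
      have := pow_le_pow_left₀ (norm_nonneg _) h3 2
      nlinarith [norm_nonneg (y - z)]
    have h5 : M / 2 * ‖y - z'‖ ^ 2 ≤ M / 2 * (‖y - z‖ ^ 2 + e * (2 * D + 1)) := by gcongr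
    have h6 : 0 ≤ e * (M * (2 * D + 1)) := by positivity
    nlinarith

end Solution

/-! ### Geometry of the mesh -/

section Mesh

variable {Ω : Set (Space d)} {σ κ : ℝ} {K : Geometry.SimplicialComplex ℝ (Space d)}

theorem IsMesh.exists_element (hK : IsMesh Ω σ κ K) {y : Space d} (hy : y ∈ K.space) :
    ∃ t ∈ elements K, y ∈ convexHull ℝ (t : Set (Space d)) := by
  obtain ⟨s, hs, hys⟩ := Geometry.SimplicialComplex.mem_space_iff.1 hy
  obtain ⟨t, ht, hst⟩ := hK.pure s hs
  exact ⟨t, ht, convexHull_mono (by exact_mod_cast hst) hys⟩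

theorem mem_vertices_of_mem_elements {t : Finset (Space d)} (ht : t ∈ elements K) {z : Space d}
    (hz : z ∈ t) : z ∈ K.vertices :=
  K.down_closed ht.1 (by simpa using hz) (by simp)

theorem vertices_subset_space : K.vertices ⊆ K.space := fun z hz =>
  Geometry.SimplicialComplex.mem_space_iff.2 ⟨{z}, hz, by simp⟩

theorem boundary_or_interior {z : Space d} (hz : z ∈ K.vertices) :
    z ∈ boundaryNodes K ∨ z ∈ interiorNodes K :=
  or_iff_not_imp_left.2 fun h => ⟨hz, h⟩

theorem IsMesh.vertices_finite (hK : IsMesh Ω σ κ K) : K.vertices.Finite :=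
  hK.finite.preimage Finset.singleton_injective.injOn

theorem IsMesh.isCompact_space (hK : IsMesh Ω σ κ K) : IsCompact K.space :=
  hK.finite.isCompact_biUnion fun t _ => t.finite_toSet.isCompact_convexHull ℝ

theorem IsMesh.elements_finite (hK : IsMesh Ω σ κ K) : (elements K).Finite :=
  hK.finite.subset fun _ h => h.1

theorem IsMesh.dist_le_meshSize (hK : IsMesh Ω σ κ K) {t : Finset (Space d)} (ht : t ∈ elements K)
    {y z : Space d} (hy : y ∈ convexHull ℝ (t : Set (Space d)))
    (hz : z ∈ convexHull ℝ (t : Set (Space d))) : dist y z ≤ meshSize K :=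
  (Metric.dist_le_diam_of_mem (t.finite_toSet.isCompact_convexHull ℝ).isBounded hy hz).trans <|
    le_csSup (hK.elements_finite.image _).bddAbove ⟨t, ht, rfl⟩

theorem IsMesh.meshSize_pos (hd : 1 ≤ d) (hK : IsMesh Ω σ κ K) (hne : K.space.Nonempty) :
    0 < meshSize K := by
  obtain ⟨y, hy⟩ := hne
  obtain ⟨t, ht, -⟩ := hK.exists_element hy
  obtain ⟨a, ha, b, hb, hab⟩ := Finset.one_lt_card.1 (by rw [ht.2]; omega : 1 < t.card)
  exact (dist_pos.2 hab).trans_le <| hK.dist_le_meshSize ht (subset_convexHull _ _ ha)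
    (subset_convexHull _ _ hb)

/-- The computational domain is the closed convex hull of its extreme points, and an extreme point is
a vertex of the element containing it and lies on the boundary, that is, on `∂Ω`. -/
theorem IsMesh.space_subset_closure (hd : 1 ≤ d) (hK : IsMesh Ω σ κ K) (hΩ : Convex ℝ Ω) :
    K.space ⊆ closure Ω := by
  have : Nonempty (Fin d) := ⟨⟨0, hd⟩⟩
  rw [← closure_convexHull_extremePoints hK.isCompact_space hK.convex_space]
  refine closure_minimal (convexHull_min (fun x hx => ?_) hΩ.closure) isClosed_closure
  obtain ⟨t, ht, hxt⟩ := hK.exists_element (extremePoints_subset hx)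
  have hxt' : x ∈ (t : Set (Space d)) := extremePoints_convexHull_subset (𝕜 := ℝ) <|
    inter_extremePoints_subset_extremePoints_of_subset
      (K.convexHull_subset_space ht.1) ⟨hxt, hx⟩
  refine frontier_subset_closure <| hK.boundaryNodes_subset
    ⟨mem_vertices_of_mem_elements ht hxt', subset_closure (extremePoints_subset hx), fun hint => ?_⟩
  obtain ⟨r, hr, hball⟩ := Metric.mem_nhds_iff.1 (mem_interior_iff_mem_nhds.1 hint)
  set e : Space d := EuclideanSpace.single (Classical.arbitrary _) (r / 2)
  have he : ‖e‖ = r / 2 := by simp [e, abs_of_pos hr]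
  have h1 : x + e ∈ K.space := hball (by
    simp only [mem_ball_iff_norm, add_sub_cancel_left, he]; linarith)
  have h2 : x - e ∈ K.space := hball (by
    simp only [mem_ball_iff_norm, sub_sub_cancel_left, norm_neg, he]; linarith)
  have h3 : x + e = x := by
    refine hx.2 h1 h2 ⟨1 / 2, 1 / 2, by norm_num, by norm_num, by norm_num, ?_⟩
    module
  have h4 : e = 0 := by simpa using h3
  rw [h4, norm_zero] at he
  linarith

theorem IsMesh.interior_space_subset (hd : 1 ≤ d) (hK : IsMesh Ω σ κ K) (hΩc : Convex ℝ Ω)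
    (hΩ : IsOpen Ω) (hne : Ω.Nonempty) : interior K.space ⊆ Ω := by
  refine (interior_mono (hK.space_subset_closure hd hΩc)).trans ?_
  rw [hΩc.interior_closure_eq_interior_of_nonempty_interior (by rwa [hΩ.interior_eq]),
    hΩ.interior_eq]

theorem IsMesh.mem_interior_of_mem_interiorNodes {x : Space d} (hx : x ∈ interiorNodes K) :
    x ∈ interior K.space := by
  by_contra h
  exact hx.2 ⟨hx.1, subset_closure (vertices_subset_space hx.1), h⟩

/-- Each vertex that occurs with a positive barycentric coordinate in a boundary point is itself a
boundary node: otherwise the point would be interior by convexity. -/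
theorem IsMesh.exists_boundaryNode_dist_le (hK : IsMesh Ω σ κ K) {y : Space d}
    (hy : y ∈ frontier K.space) : ∃ z ∈ boundaryNodes K, dist y z ≤ meshSize K := by
  have hyK : y ∈ K.space := hK.isCompact_space.isClosed.frontier_subset hy
  obtain ⟨t, ht, hyt⟩ := hK.exists_element hyK
  obtain ⟨c, hc0, hc1, hcy⟩ := Finset.mem_convexHull'.1 hyt
  obtain ⟨z, hzt, hz⟩ : ∃ z ∈ t, 0 < c z := by
    by_contra! h
    have := Finset.sum_nonpos h
    rw [hc1] at this
    linarith
  refine ⟨z, ⟨mem_vertices_of_mem_elements ht hzt,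
    subset_closure (K.subset_space ht.1 hzt), fun hint => hy.2 ?_⟩,
    hK.dist_le_meshSize ht hyt (subset_convexHull _ _ hzt)⟩
  -- If the weight of `z` is `1`, then `y = z`; otherwise `y` is a proper combination of `z` and a
  -- point of the element.
  rcases (Finset.single_le_sum hc0 hzt).eq_or_lt with h1 | h1
  · have : y = z := by
      rw [← hcy, Finset.sum_eq_single_of_mem z hzt, h1, hc1, one_smul]
      intro b hb hbz
      have h2 := Finset.sum_erase_add t c hzt
      have h3 : ∑ x ∈ t.erase z, c x = 0 := by linarith
      rw [(Finset.sum_eq_zero_iff_of_nonneg fun i hi => hc0 i (Finset.mem_of_mem_erase hi)).1 h3 b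
        (Finset.mem_erase.2 ⟨hbz, hb⟩), zero_smul]
    rwa [this]
  · rw [hc1] at h1
    have hmem : ∑ x ∈ t.erase z, (c x / (1 - c z)) • x ∈ K.space := by
      refine K.convexHull_subset_space ht.1 ?_
      refine (convex_convexHull ℝ _).sum_mem (fun i hi => ?_) ?_ fun i hi =>
        subset_convexHull _ _ (Finset.mem_of_mem_erase hi)
      · exact div_nonneg (hc0 i (Finset.mem_of_mem_erase hi)) (by linarith)
      · rw [← Finset.sum_div, div_eq_one_iff_eq (by linarith)]
        linarith [Finset.sum_erase_add t c hzt]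
    have := hK.convex_space.combo_interior_self_mem_interior hint hmem hz (by linarith : 0 ≤ 1 - c z)
      (by ring)
    convert this using 1
    rw [← hcy, ← Finset.add_sum_erase t _ hzt, Finset.smul_sum]
    congr 1
    refine Finset.sum_congr rfl fun i _ => ?_
    rw [smul_smul, mul_div_cancel₀ _ (by linarith)]

theorem IsMesh.exists_max_node (hK : IsMesh Ω σ κ K) (hne : K.space.Nonempty) (F : Space d → ℝ) :
    ∃ x ∈ K.vertices, ∀ z ∈ K.vertices, F z ≤ F x := by
  obtain ⟨y, hy⟩ := hne
  obtain ⟨t, ht, -⟩ := hK.exists_element hy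
  obtain ⟨z, hz⟩ := K.nonempty_of_mem_faces ht.1
  exact Set.exists_max_image _ F hK.vertices_finite ⟨z, mem_vertices_of_mem_elements ht hz⟩

theorem localScale_pos {δ : ℝ} (hδ : 0 < δ) {x : Space d} (hx : x ∈ interior K.space)
    (hK : K.spaceᶜ.Nonempty) : 0 < localScale K δ x := by
  refine lt_min hδ ?_
  rw [← Metric.infDist_closure, closure_compl]
  exact (isOpen_interior.isClosed_compl.notMem_iff_infDist_pos
    (by rw [← closure_compl]; exact hK.closure)).1 (by simpa using hx)

theorem ball_localScale_subset {δ : ℝ} {x : Space d} :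
    Metric.ball x (localScale K δ x) ⊆ K.space :=
  (Metric.ball_subset_ball (min_le_right _ _)).trans
    (by simpa using (Metric.disjoint_ball_infDist (x := x) (s := K.spaceᶜ)).subset_compl_right)

end Mesh

/-! ### Bounds for the two-scale operator -/

section Operator

variable {θ δ : ℝ} {K : Geometry.SimplicialComplex ℝ (Space d)} {N : DirectionNet d θ}
  {w : Space d → ℝ} {x : Space d}

theorem prod_lt_prod_of_nonneg_of_lt (hd : 1 ≤ d) {a b : Fin d → ℝ} (ha : ∀ i, 0 ≤ a i)
    (hab : ∀ i, a i < b i) : ∏ i, a i < ∏ i, b i := by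
  have : Nonempty (Fin d) := ⟨⟨0, hd⟩⟩
  have hb : 0 < ∏ i, b i := Finset.prod_pos fun i _ => (ha i).trans_lt (hab i)
  by_cases h : ∃ i, a i = 0
  · obtain ⟨i, hi⟩ := h
    rwa [Finset.prod_eq_zero (Finset.mem_univ i) hi]
  · push Not at h
    exact Finset.prod_lt_prod_of_nonempty (fun i _ => (ha i).lt_of_ne' (h i)) (fun i _ => hab i)
      Finset.univ_nonempty

theorem twoScaleOp_lt_prod (hd : 1 ≤ d) {v : Fin d → Space d} (hv : v ∈ N.bases) {lam : Fin d → ℝ}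
    (hlam : ∀ j, 0 < lam j) (h : ∀ j, secondDiff (localScale K δ x) w x (v j) < lam j) :
    twoScaleOp K δ N w x < ∏ j, lam j := by
  refine (Finset.inf'_le _ hv).trans_lt ?_
  have h1 := prod_lt_prod_of_nonneg_of_lt hd
    (a := fun j => max (secondDiff (localScale K δ x) w x (v j)) 0)
    (fun j => le_max_right _ _) fun j => max_lt (h j) (hlam j)
  have h2 : 0 ≤ ∑ j, -min (secondDiff (localScale K δ x) w x (v j)) 0 :=
    Finset.sum_nonneg fun j _ => neg_nonneg.2 (min_le_right _ _)
  linarith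

/-- If in every admissible basis the second differences strictly exceed nonnegative numbers with
product at least `c`, then the operator exceeds `c`. -/
theorem lt_twoScaleOp (hd : 1 ≤ d) {c : ℝ} {a : (Fin d → Space d) → Fin d → ℝ}
    (ha : ∀ v ∈ N.bases, ∀ j, 0 ≤ a v j) (hc : ∀ v ∈ N.bases, c ≤ ∏ j, a v j)
    (h : ∀ v ∈ N.bases, ∀ j, a v j < secondDiff (localScale K δ x) w x (v j)) :
    c < twoScaleOp K δ N w x := by
  refine (Finset.lt_inf'_iff _).2 fun v hv => ?_
  have h1 := prod_lt_prod_of_nonneg_of_lt hd (ha v hv) fun j =>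
    (h v hv j).trans_le (le_max_left _ 0)
  have h2 : ∑ j, -min (secondDiff (localScale K δ x) w x (v j)) 0 = 0 :=
    Finset.sum_eq_zero fun j _ => by
      rw [min_eq_right ((ha v hv j).trans (h v hv j).le), neg_zero]
  rw [h2, sub_zero]
  exact (hc v hv).trans_lt h1

theorem twoScaleOp_nonpos (hd : 1 ≤ d)
    (h : ∀ v ∈ N.bases, ∀ j, secondDiff (localScale K δ x) w x (v j) ≤ 0) :
    twoScaleOp K δ N w x ≤ 0 := by
  obtain ⟨v, hv⟩ := N.bases_nonempty
  refine (Finset.inf'_le _ hv).trans ?_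
  have h1 : ∏ j, max (secondDiff (localScale K δ x) w x (v j)) 0 = 0 :=
    Finset.prod_eq_zero (Finset.mem_univ ⟨0, hd⟩) (max_eq_right (h v hv _))
  have h2 : 0 ≤ ∑ j, -min (secondDiff (localScale K δ x) w x (v j)) 0 :=
    Finset.sum_nonneg fun j _ => neg_nonneg.2 (min_le_right _ _)
  linarith

end Operator

/-! ### Piecewise affine functions and their extremal nodes -/

theorem IsPiecewiseLinear.exists_weights {Ω : Set (Space d)} {σ κ : ℝ}
    {K : Geometry.SimplicialComplex ℝ (Space d)} {w : Space d → ℝ} (hw : IsPiecewiseLinear K w)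
    (hK : IsMesh Ω σ κ K) {y : Space d} (hy : y ∈ K.space) :
    ∃ t ∈ elements K, ∃ c : Space d → ℝ, (∀ z ∈ t, 0 ≤ c z) ∧ ∑ z ∈ t, c z = 1 ∧
      ∑ z ∈ t, c z • z = y ∧ w y = ∑ z ∈ t, c z * w z := by
  obtain ⟨t, ht, hyt⟩ := hK.exists_element hy
  obtain ⟨c, hc0, hc1, hcy⟩ := Finset.mem_convexHull'.1 hyt
  obtain ⟨A, hA⟩ := hw.affine_on t ht
  refine ⟨t, ht, c, hc0, hc1, hcy, ?_⟩
  have hdec : ∀ z, A z = A.linear z + A 0 := fun z => by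
    have := congrFun A.decomp z
    simpa using this
  have hsum : ∑ z ∈ t, c z * w z = ∑ z ∈ t, (c z * A.linear z + c z * A 0) :=
    Finset.sum_congr rfl fun z hz => by rw [hA (subset_convexHull _ _ hz), hdec, mul_add]
  rw [hsum, Finset.sum_add_distrib, ← Finset.sum_mul, hc1, one_mul, hA hyt, hdec, ← hcy, map_sum]
  simp only [map_smul, smul_eq_mul]

/-- On every element the piecewise affine interpolant of `v` is at most `v + e`. The interpolant
enters only through barycentric combinations of nodal values, so it is not constructed. -/
def InterpolationLE (K : Geometry.SimplicialComplex ℝ (Space d)) (v : Space d → ℝ) (e : ℝ) : Prop :=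
  ∀ t ∈ elements K, ∀ c : Space d → ℝ, (∀ z ∈ t, 0 ≤ c z) → ∑ z ∈ t, c z = 1 →
    ∑ z ∈ t, c z * v z ≤ v (∑ z ∈ t, c z • z) + e

theorem le_of_le_at_nodes {Ω : Set (Space d)} {σ κ : ℝ} {K : Geometry.SimplicialComplex ℝ (Space d)}
    (hK : IsMesh Ω σ κ K) {w v : Space d → ℝ} (hw : IsPiecewiseLinear K w) {e m : ℝ}
    (hv : InterpolationLE K v e) (hm : ∀ z ∈ K.vertices, w z ≤ v z + m) {y : Space d}
    (hy : y ∈ K.space) : w y ≤ v y + e + m := by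
  obtain ⟨t, ht, c, hc0, hc1, hcy, hwy⟩ := hw.exists_weights hK hy
  have h1 := hv t ht c hc0 hc1
  rw [hcy] at h1
  have h2 : w y ≤ ∑ z ∈ t, c z * (v z + m) := by
    rw [hwy]
    exact Finset.sum_le_sum fun z hz =>
      mul_le_mul_of_nonneg_left (hm z (mem_vertices_of_mem_elements ht hz)) (hc0 z hz)
  simp only [mul_add, Finset.sum_add_distrib] at h2
  rw [← Finset.sum_mul, hc1, one_mul] at h2
  linarith

/-- At a point where `w - v` takes the value `m` and, up to `e`, its maximum, the second differences
of `w` are bounded by those of `v`. -/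
theorem secondDiff_le_of_max {S : Set (Space d)} {w v : Space d → ℝ} {e m s : ℝ} {x a : Space d}
    (h : ∀ y ∈ S, w y ≤ v y + e + m) (hx : w x = v x + m) (h1 : x + s • a ∈ S)
    (h2 : x - s • a ∈ S) : secondDiff s w x a ≤ secondDiff s v x a + 2 * e / s ^ 2 := by
  rw [secondDiff, secondDiff, ← add_div]
  refine div_le_div_of_nonneg_right ?_ (sq_nonneg s)
  linarith [h _ h1, h _ h2]

/-- The quadratic function `|y - x₀|² / 2`. -/
noncomputable def quad (x₀ y : Space d) : ℝ := ‖y - x₀‖ ^ 2 / 2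

theorem quad_nonneg (x₀ y : Space d) : 0 ≤ quad x₀ y := by unfold quad; positivity

theorem secondDiff_add_quad {s : ℝ} (hs : s ≠ 0) (c : ℝ) (u : Space d → ℝ) (x₀ x : Space d)
    {a : Space d} (ha : ‖a‖ = 1) :
    secondDiff s (fun y => u y + c * quad x₀ y) x a = secondDiff s u x a + c := by
  have h := parallelogram_law_with_norm ℝ (x - x₀) (s • a)
  rw [norm_smul, ha, mul_one, Real.norm_eq_abs, sq_abs] at h
  have hq : quad x₀ (x + s • a) + quad x₀ (x - s • a) - 2 * quad x₀ x = s ^ 2 := by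
    simp only [quad]
    rw [show x + s • a - x₀ = x - x₀ + s • a by abel, show x - s • a - x₀ = x - x₀ - s • a by abel]
    linarith
  simp only [secondDiff]
  field_simp
  linear_combination c * hq

theorem convexOn_quad (x₀ : Space d) : ConvexOn ℝ Set.univ (quad x₀) := by
  have h := ((convexOn_univ_norm (E := Space d)).translate_right (-x₀)).pow
    (fun _ _ => norm_nonneg _) 2
  have h2 := h.smul (by norm_num : (0 : ℝ) ≤ 1 / 2)
  refine (by simpa using h2 : ConvexOn ℝ Set.univ _).congr fun y _ => ?_
  simp [quad, ← sub_eq_neg_add]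
  ring

/-! ### Barriers and one-sided error bounds -/

/-- A classical convex solution of the Dirichlet problem with positive right-hand side on a bounded
open convex set, with a nonempty mesh. Uniform convexity of the set is not part of it. -/
structure Setting (Ω : Set (Space d)) (k : ℕ) (α : ℝ) (f g u : Space d → ℝ) (σ κ : ℝ)
    (K : Geometry.SimplicialComplex ℝ (Space d)) : Prop where
  dim_pos : 1 ≤ d
  isOpen : IsOpen Ω
  nonempty : Ω.Nonempty
  isBounded : Bornology.IsBounded Ω
  convex : Convex ℝ Ω
  order : k = 0 ∨ k = 1
  exponent_pos : 0 < α
  exponent_le_one : α ≤ 1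
  rhs_pos : ∀ x ∈ Ω, 0 < f x
  solution : IsConvexSolution Ω f g u
  regular : IsHolderClass (2 + k) α Ω u
  mesh : IsMesh Ω σ κ K
  space_nonempty : K.space.Nonempty

namespace Setting

variable {Ω : Set (Space d)} {k : ℕ} {α : ℝ} {f g u : Space d → ℝ} {σ κ : ℝ}
  {K : Geometry.SimplicialComplex ℝ (Space d)} (S : Setting Ω k α f g u σ κ K)
include S

theorem space_subset : K.space ⊆ closure Ω := S.mesh.space_subset_closure S.dim_pos S.convex

theorem compl_space_nonempty : K.spaceᶜ.Nonempty := by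
  have : Nonempty (Fin d) := ⟨⟨0, S.dim_pos⟩⟩
  exact Set.nonempty_compl.2 S.mesh.isCompact_space.ne_univ

theorem localScale_pos {δ : ℝ} (hδ : 0 < δ) {x : Space d} (hx : x ∈ interiorNodes K) :
    0 < localScale K δ x :=
  TwoScaleMA.localScale_pos hδ (IsMesh.mem_interior_of_mem_interiorNodes hx) S.compl_space_nonempty

theorem ball_subset {δ : ℝ} {x : Space d} : Metric.ball x (localScale K δ x) ⊆ Ω :=
  (interior_maximal ball_localScale_subset Metric.isOpen_ball).trans
    (S.mesh.interior_space_subset S.dim_pos S.convex S.isOpen S.nonempty)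

theorem mem_domain {x : Space d} (hx : x ∈ interiorNodes K) : x ∈ Ω :=
  S.mesh.interior_space_subset S.dim_pos S.convex S.isOpen S.nonempty
    (IsMesh.mem_interior_of_mem_interiorNodes hx)

theorem mem_space {δ : ℝ} (hδ : 0 < δ) {x a : Space d} (hx : x ∈ interiorNodes K) (ha : ‖a‖ = 1) :
    x + localScale K δ x • a ∈ K.space ∧ x - localScale K δ x • a ∈ K.space := by
  have hs := S.localScale_pos hδ hx
  have h : Metric.closedBall x (localScale K δ x) ⊆ K.space := by
    rw [← closure_ball x hs.ne']
    exact closure_minimal ball_localScale_subset S.mesh.isCompact_space.isClosed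
  constructor <;> apply h <;> simp [norm_smul, ha, abs_of_pos hs]

theorem dist_le_diam {x y : Space d} (hx : x ∈ closure Ω) (hy : y ∈ closure Ω) :
    ‖x - y‖ ≤ Metric.diam (closure Ω) := by
  rw [← dist_eq_norm]
  exact Metric.dist_le_diam_of_mem S.isBounded.closure hx hy

theorem quad_le {x y : Space d} (hx : x ∈ closure Ω) (hy : y ∈ closure Ω) :
    quad x y ≤ Metric.diam (closure Ω) ^ 2 / 2 :=
  div_le_div_of_nonneg_right (pow_le_pow_left₀ (norm_nonneg _) (S.dist_le_diam hy hx) 2)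
    (by norm_num)

theorem boundary_eq {δ θ : ℝ} {N : DirectionNet d θ} {uε : Space d → ℝ}
    (h : IsDiscreteSolution K δ N f g uε) {z : Space d} (hz : z ∈ boundaryNodes K) :
    uε z = u z := by
  rw [h.boundary z hz, S.solution.boundary z (S.mesh.boundaryNodes_subset hz)]

/-- The interpolant of `u - c q` exceeds this function by at most `M h² / 2`. The concave part
`-c q` contributes no error of its own. -/
theorem interpolation_le (c : ℝ) (hc : 0 ≤ c) (x₀ : Space d) :
    InterpolationLE K (fun y => u y + -c * quad x₀ y)
      (w2InfSeminorm Ω u / 2 * meshSize K ^ 2) := by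
  intro t ht a ha0 ha1
  set y := ∑ z ∈ t, a z • z with hy
  have hM : 0 ≤ w2InfSeminorm Ω u := w2InfSeminorm_nonneg
  have htΩ : convexHull ℝ (t : Set (Space d)) ⊆ closure Ω :=
    (K.convexHull_subset_space ht.1).trans S.space_subset
  have hyt : y ∈ convexHull ℝ (t : Set (Space d)) := Finset.mem_convexHull'.2 ⟨a, ha0, ha1, rfl⟩
  have hquad : quad x₀ y ≤ ∑ z ∈ t, a z * quad x₀ z :=
    (convexOn_quad x₀).map_sum_le ha0 ha1 fun _ _ => trivial
  have hu : ∑ z ∈ t, a z * u z ≤ u y + w2InfSeminorm Ω u / 2 * meshSize K ^ 2 := by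
    refine le_of_forall_pos_le_add fun η hη => ?_
    obtain ⟨L, c, h1, h2⟩ := exists_affine_minorant S.order S.exponent_pos S.exponent_le_one S.isOpen
      S.isBounded S.convex S.regular S.solution.convexOn (htΩ hyt) hη
    have h3 : ∑ z ∈ t, a z * u z ≤
        ∑ z ∈ t, a z * (L z + (c + w2InfSeminorm Ω u / 2 * meshSize K ^ 2 + η)) := by
      refine Finset.sum_le_sum fun z hz => mul_le_mul_of_nonneg_left ?_ (ha0 z hz)
      have hzt := subset_convexHull ℝ _ (Finset.mem_coe.2 hz)
      have h4 : ‖z - y‖ ≤ meshSize K := by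
        rw [← dist_eq_norm]; exact S.mesh.dist_le_meshSize ht hzt hyt
      have h5 : w2InfSeminorm Ω u / 2 * ‖z - y‖ ^ 2 ≤ w2InfSeminorm Ω u / 2 * meshSize K ^ 2 := by
        gcongr
      linarith [h2 z (htΩ hzt)]
    simp only [mul_add _ (L _), Finset.sum_add_distrib] at h3
    rw [← Finset.sum_mul, ha1, one_mul] at h3
    have h6 : ∑ z ∈ t, a z * L z = L y := by simp [hy, map_sum]
    linarith [h1 y (htΩ hyt)]
  have hsplit : ∑ z ∈ t, a z * (u z + -c * quad x₀ z) =
      ∑ z ∈ t, a z * u z - c * ∑ z ∈ t, a z * quad x₀ z := by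
    rw [Finset.mul_sum, ← Finset.sum_sub_distrib]
    exact Finset.sum_congr rfl fun z _ => by ring
  rw [hsplit]
  have := mul_le_mul_of_nonneg_left hquad hc
  linarith

variable {δ θ : ℝ} {N : DirectionNet d θ} {uε : Space d → ℝ}

/-- Lower bound for the discrete solution, by comparison with `u + c q`, `c = 2 M min(θ², 1)`. -/
theorem sub_le (hδ : 0 < δ) (hθ : 0 < θ) (hM : 0 < w2InfSeminorm Ω u)
    (hHδ : holderSeminorm (2 + k) α Ω u * δ ^ (k + α) ≤ w2InfSeminorm Ω u * θ ^ 2)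
    (h : IsDiscreteSolution K δ N f g uε) {x : Space d} (hx : x ∈ K.space) :
    u x - uε x ≤ w2InfSeminorm Ω u * min (θ ^ 2) 1 * Metric.diam (closure Ω) ^ 2 := by
  set M := w2InfSeminorm Ω u
  obtain ⟨x₀, hx₀⟩ := S.nonempty
  set c := 2 * M * min (θ ^ 2) 1 with hcdef
  have hc : 0 < c := by positivity
  set v : Space d → ℝ := fun y => u y + c * quad x₀ y with hv
  have hw : IsPiecewiseLinear K (fun y => -uε y) := by
    refine ⟨h.piecewiseLinear.continuousOn.neg, fun t ht => ?_⟩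
    obtain ⟨A, hA⟩ := h.piecewiseLinear.affine_on t ht
    exact ⟨-A, fun y hy => by simp [hA hy]⟩
  have hvI : InterpolationLE K (fun y => -v y) 0 := by
    intro t ht a ha0 ha1
    have hconv : ConvexOn ℝ (closure Ω) v := S.solution.convexOn.add
      (((convexOn_quad x₀).subset (Set.subset_univ _) S.convex.closure).smul hc.le)
    have := hconv.map_sum_le ha0 ha1 fun z hz =>
      S.space_subset (K.subset_space ht.1 hz)
    simp only [smul_eq_mul] at this
    simp only [mul_neg, Finset.sum_neg_distrib]
    linarith
  obtain ⟨p, hp, hmax⟩ := S.mesh.exists_max_node S.space_nonempty fun y => v y - uε y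
  have hle : ∀ y ∈ K.space, -uε y ≤ -v y + 0 + (v p - uε p) := fun y hy =>
    le_of_le_at_nodes S.mesh hw hvI (fun z hz => by linarith [hmax z hz]) hy
  -- At an interior node the second differences of `uε` would exceed those of the Hessian.
  have hpb : p ∈ boundaryNodes K := by
    refine (boundary_or_interior hp).resolve_right fun hpi => ?_
    have hpΩ := S.mem_domain hpi
    have hs := S.localScale_pos hδ hpi
    set s := localScale K δ p with hsdef
    obtain ⟨L, b, lam, -, hL, hb, hlam, hdet⟩ := exists_spectral S.order S.exponent_pos
      S.exponent_le_one S.isOpen S.regular S.solution hpΩ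
    refine lt_irrefl (f p) ((lt_twoScaleOp (N := N) (K := K) (δ := δ) (w := uε) (x := p) S.dim_pos
      (a := fun v j => dirDeriv 2 u p (v j))
      (fun v _ j => dirDeriv_two_nonneg S.order S.exponent_pos S.exponent_le_one S.isOpen
        S.regular S.solution.convexOn hpΩ _) (fun v hv => ?_)
      fun a ha j => ?_).trans_eq (h.interior p hpi))
    · rw [← hdet]
      simp only [hL, apply_self_eq_sum_eigenvalues hb]
      exact prod_eigenvalues_le hlam b (N.orthonormal_bases v hv)
    · have haj : ‖a j‖ = 1 := (N.orthonormal_bases a ha).1 j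
      obtain ⟨hm1, hm2⟩ := S.mem_space hδ hpi haj
      have h1 := secondDiff_le_of_max hle (by ring) hm1 hm2
      have h2 : ∀ w : Space d → ℝ, secondDiff s (fun y => -w y) p (a j) =
          -secondDiff s w p (a j) := fun w => by simp only [secondDiff]; ring
      rw [← hsdef, h2, h2, hv, secondDiff_add_quad hs.ne' _ _ _ _ haj] at h1
      have h3 : 0 ≤ secondDiff s u p (a j) := secondDiff_nonneg S.solution.convexOn
        (S.space_subset hm1) (S.space_subset hm2)
      have h4 := (abs_le.1 (abs_secondDiff_sub_le S.order S.exponent_pos S.exponent_le_one S.isOpen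
        S.regular haj hs S.ball_subset)).1
      have h5 : holderSeminorm (2 + k) α Ω u * s ^ (k + α) ≤ M * θ ^ 2 := by
        refine le_trans ?_ hHδ
        refine mul_le_mul_of_nonneg_left (Real.rpow_le_rpow hs.le (min_le_left _ _) ?_) ?_
        · have := S.exponent_pos; positivity
        · refine Real.sSup_nonneg ?_
          rintro _ ⟨a, -, b, -, -, rfl⟩
          positivity
      have h6 : dirDeriv 2 u p (a j) ≤ M := by
        simpa [haj] using dirDeriv_two_le S.regular S.isBounded hpΩ (a j)
      simp only [mul_zero, zero_div, add_zero] at h1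
      -- For `θ² ≥ 1` consistency is useless, but `u` is convex and `D²u(w, w) ≤ M < c`.
      rcases le_total (θ ^ 2) 1 with hθ1 | hθ1
      · rw [min_eq_left hθ1] at hcdef
        have : 0 < M * θ ^ 2 := by positivity
        linarith
      · rw [min_eq_right hθ1] at hcdef
        linarith
  have h7 := hle x hx
  rw [S.boundary_eq h hpb] at h7
  have h8 : c * quad x₀ p ≤ c * (Metric.diam (closure Ω) ^ 2 / 2) :=
    mul_le_mul_of_nonneg_left (S.quad_le (subset_closure hx₀)
      (S.space_subset (vertices_subset_space hp))) hc.le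
  have h9 := mul_nonneg hc.le (quad_nonneg x₀ x)
  simp only [hv] at h7
  have : c * (Metric.diam (closure Ω) ^ 2 / 2) = M * min (θ ^ 2) 1 * Metric.diam (closure Ω) ^ 2 := by
    rw [hcdef]; ring
  linarith

/-- Affine barrier at a boundary point `z`: by the enclosing sphere condition,
`|y - z|² / 2 ≤ ⟨z - o, z - y⟩` on `Ω`, where `o` is the center of the enclosing ball. So a tangent
plane plus `M ⟨z - o, z - y⟩` lies above `u`, and hence above `uε`, because the
operator is nonpositive where all second differences are. -/
theorem le_add_dist (hδ : 0 < δ) {R : ℝ}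
    (hR : ∀ z ∈ frontier Ω, ∃ c : Space d, dist z c = R ∧ Ω ⊆ Metric.closedBall c R)
    (h : IsDiscreteSolution K δ N f g uε) {x z : Space d} (hx : x ∈ K.space)
    (hz : z ∈ frontier Ω) : uε x ≤ u x + w2InfSeminorm Ω u * R * ‖x - z‖ := by
  set M := w2InfSeminorm Ω u
  have hM : 0 ≤ M := w2InfSeminorm_nonneg
  refine le_of_forall_pos_le_add fun η hη => ?_
  obtain ⟨L, c, h1, h2⟩ := exists_affine_minorant S.order S.exponent_pos S.exponent_le_one S.isOpen
    S.isBounded S.convex S.regular S.solution.convexOn (frontier_subset_closure hz) hη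
  obtain ⟨o, hzo, hΩo⟩ := hR z hz
  have hball : ∀ y ∈ closure Ω, ‖y - z‖ ^ 2 / 2 ≤ inner ℝ (z - o) (z - y) := by
    intro y hy
    have hy' : ‖y - o‖ ≤ R := by
      simpa [dist_eq_norm] using closure_minimal hΩo Metric.isClosed_closedBall hy
    rw [dist_eq_norm] at hzo
    have h3 := norm_sub_sq_real (z - o) (z - y)
    rw [show z - o - (z - y) = y - o by abel, hzo, norm_sub_rev z y] at h3
    have h4 := pow_le_pow_left₀ (norm_nonneg _) hy' 2
    linarith
  set ℓ : Space d → ℝ := fun y => L y + c + M * inner ℝ (z - o) (z - y) + η with hℓ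
  have hℓI : InterpolationLE K ℓ 0 := by
    intro t ht a ha0 ha1
    have : ∀ y, ℓ y = (L - M • innerSL ℝ (z - o)) y + (c + M * inner ℝ (z - o) z + η) := fun y => by
      simp only [hℓ, inner_sub_right, _root_.sub_apply, _root_.smul_apply, innerSL_apply_apply,
        smul_eq_mul]
      ring
    simp only [this, mul_add _ ((L - M • innerSL ℝ (z - o)) _), Finset.sum_add_distrib]
    rw [← Finset.sum_mul, ha1, one_mul, map_sum]
    simp only [map_smul, smul_eq_mul, add_zero, le_refl]
  obtain ⟨p, hp, hmax⟩ := S.mesh.exists_max_node S.space_nonempty fun y => uε y - ℓ y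
  have hle : ∀ y ∈ K.space, uε y ≤ ℓ y + 0 + (uε p - ℓ p) := fun y hy =>
    le_of_le_at_nodes S.mesh h.piecewiseLinear hℓI (fun z hz => by linarith [hmax z hz]) hy
  have hpb : p ∈ boundaryNodes K := by
    refine (boundary_or_interior hp).resolve_right fun hpi => ?_
    refine (S.rhs_pos p (S.mem_domain hpi)).not_ge ?_
    rw [← h.interior p hpi]
    refine twoScaleOp_nonpos S.dim_pos fun a ha j => ?_
    obtain ⟨hm1, hm2⟩ := S.mem_space hδ hpi ((N.orthonormal_bases a ha).1 j)
    refine (secondDiff_le_of_max hle (by ring) hm1 hm2).trans_eq ?_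
    simp only [secondDiff, hℓ, map_add, map_sub, inner_sub_right, inner_add_right]
    ring
  have h3 := hle x hx
  rw [S.boundary_eq h hpb] at h3
  have hpΩ := S.space_subset (vertices_subset_space hp)
  have h4 : u p ≤ ℓ p := by
    have := mul_le_mul_of_nonneg_left (hball p hpΩ) hM
    linarith [h2 p hpΩ]
  have h5 : M * inner ℝ (z - o) (z - x) ≤ M * R * ‖x - z‖ := by
    rw [mul_assoc]
    refine mul_le_mul_of_nonneg_left ?_ hM
    have := real_inner_le_norm (z - o) (z - x)
    rwa [← dist_eq_norm, hzo, norm_sub_rev] at this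
  linarith [h1 x (S.space_subset hx)]

/-- Upper bound for the discrete solution, by comparison with `u - c q`, `c = 4 M θ²`, at the nodes
of distance at least `δ` to the boundary, and by the affine barrier at the other nodes. -/
theorem le_add (hδ : 0 < δ) (hθ : 0 < θ) (hM : 0 < w2InfSeminorm Ω u)
    (hHδ : holderSeminorm (2 + k) α Ω u * δ ^ (k + α) ≤ w2InfSeminorm Ω u * θ ^ 2)
    (hhδ : meshSize K ^ 2 ≤ θ ^ 2 * δ ^ 2) {R : ℝ} (hR0 : 0 < R)
    (hR : ∀ z ∈ frontier Ω, ∃ c : Space d, dist z c = R ∧ Ω ⊆ Metric.closedBall c R)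
    (h : IsDiscreteSolution K δ N f g uε) {x : Space d} (hx : x ∈ K.space) :
    uε x - u x ≤ w2InfSeminorm Ω u * (R * (δ + meshSize K) +
      2 * θ ^ 2 * Metric.diam (closure Ω) ^ 2 + meshSize K ^ 2 / 2) := by
  set M := w2InfSeminorm Ω u
  obtain ⟨x₀, hx₀⟩ := S.nonempty
  have hh : 0 < meshSize K := S.mesh.meshSize_pos S.dim_pos S.space_nonempty
  set c := 4 * M * θ ^ 2 with hcdef
  have hc : 0 < c := by positivity
  set v : Space d → ℝ := fun y => u y + -c * quad x₀ y with hv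
  obtain ⟨p, hp, hmax⟩ := S.mesh.exists_max_node S.space_nonempty fun y => uε y - v y
  have hle : ∀ y ∈ K.space, uε y ≤ v y + M / 2 * meshSize K ^ 2 + (uε p - v p) := fun y hy =>
    le_of_le_at_nodes S.mesh h.piecewiseLinear (S.interpolation_le c hc.le x₀)
      (fun z hz => by linarith [hmax z hz]) hy
  have hpK := vertices_subset_space hp
  have hpu : uε p ≤ u p + M * R * (δ + meshSize K) := by
    rcases boundary_or_interior hp with hpb | hpi
    · rw [S.boundary_eq h hpb]
      have : 0 ≤ M * R * (δ + meshSize K) := by positivity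
      linarith
    rcases lt_or_ge (Metric.infDist p K.spaceᶜ) δ with hlt | hge
    · obtain ⟨y, hy, hpy⟩ := exists_mem_frontier_infDist_compl_eq_dist hpK
        (Set.nonempty_compl.1 S.compl_space_nonempty)
      obtain ⟨z, hz, hyz⟩ := S.mesh.exists_boundaryNode_dist_le hy
      refine (S.le_add_dist hδ hR h hpK (S.mesh.boundaryNodes_subset hz)).trans ?_
      have : ‖p - z‖ ≤ δ + meshSize K := by
        rw [← dist_eq_norm]
        linarith [dist_triangle p y z]
      gcongr
    -- The node is far from the boundary, where the step is `δ`: compare with the eigenbasis.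
    · exfalso
      have hs : localScale K δ p = δ := min_eq_left hge
      have hpΩ := S.mem_domain hpi
      obtain ⟨L, b, lam, hsymm, hL, hb, hlam, hdet⟩ := exists_spectral S.order S.exponent_pos
        S.exponent_le_one S.isOpen S.regular S.solution hpΩ
      have hlam' : ∀ i, 0 < lam i := fun i => (hlam i).lt_of_ne' fun h0 => by
        have := S.rhs_pos p hpΩ
        rw [← hdet, Finset.prod_eq_zero (Finset.mem_univ i) h0] at this
        exact this.false
      obtain ⟨a, ha, hab⟩ := N.approx_bases b b.orthonormal
      refine lt_irrefl (f p) ((h.interior p hpi).symm.trans_lt ?_)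
      rw [← hdet]
      refine twoScaleOp_lt_prod S.dim_pos ha hlam' fun j => ?_
      have haj : ‖a j‖ = 1 := (N.orthonormal_bases a ha).1 j
      obtain ⟨hm1, hm2⟩ := S.mem_space hδ hpi haj
      have h1 := secondDiff_le_of_max hle (by ring) hm1 hm2
      have hball := S.ball_subset (δ := δ) (x := p)
      rw [hs, hv, secondDiff_add_quad hδ.ne' _ _ _ _ haj] at h1
      rw [hs] at hball ⊢
      have h4 := (abs_le.1 (abs_secondDiff_sub_le S.order S.exponent_pos S.exponent_le_one S.isOpen
        S.regular haj hδ hball)).2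
      -- `c` beats the sum of interpolation, Taylor and direction errors, each at most `M θ²`.
      have h5 : 2 * (M / 2 * meshSize K ^ 2) / δ ^ 2 ≤ M * θ ^ 2 := by
        rw [div_le_iff₀ (by positivity)]
        have := mul_le_mul_of_nonneg_left hhδ hM.le
        linarith
      have h6 : L (a j) (a j) ≤ lam j + M * θ ^ 2 :=
        apply_self_le_of_norm_sub_le hsymm (b.norm_eq_one j) haj (hlam j)
          (fun y => (hL y).symm.trans_le (dirDeriv_two_le S.regular S.isBounded hpΩ y)) hM.le (hb j)
          (hab j).2
      rw [← hL] at h6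
      have : 0 < M * θ ^ 2 := by positivity
      linarith
  have h8 : c * quad x₀ p ≤ c * (Metric.diam (closure Ω) ^ 2 / 2) :=
    mul_le_mul_of_nonneg_left (S.quad_le (subset_closure hx₀) (S.space_subset hpK)) hc.le
  have h9 := mul_nonneg hc.le (quad_nonneg x₀ x)
  have h7 := hle x hx
  simp only [hv] at h7
  have : c * (Metric.diam (closure Ω) ^ 2 / 2) = M * (2 * θ ^ 2 * Metric.diam (closure Ω) ^ 2) := by
    rw [hcdef]; ring
  linarith

end Setting

/-! ### Balance of the scales -/

/-- The choice of `δ` and `θ` in terms of `R` makes the Taylor error, the interpolation error and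
the direction error equal up to constants. Here `p - 2 = k + α`. -/
theorem scale_balance {p M H h δ θ R : ℝ} (hp : 2 < p) (hM : 0 < M) (hH : 0 < H) (hh : 0 < h)
    (hR : R = M ^ (1 / p) * H ^ (-(1 / p))) (hδ : δ = R * h ^ (2 / p))
    (hθ : θ = R⁻¹ * h ^ ((p - 2) / p)) :
    0 < δ ∧ 0 < θ ∧ H * δ ^ (p - 2) = M * θ ^ 2 ∧ h ^ 2 = θ ^ 2 * δ ^ 2 ∧
      H ^ (1 / p) * M ^ (d - 1 / p) * h ^ ((p - 2) / p) = M ^ d * θ := by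
  have hp0 : 0 < p := by linarith
  have hRpos : 0 < R := by rw [hR]; positivity
  have hRp : R ^ p = M / H := by
    rw [hR, Real.mul_rpow (by positivity) (by positivity), ← Real.rpow_mul hM.le,
      ← Real.rpow_mul hH.le, neg_mul, one_div_mul_cancel hp0.ne', Real.rpow_one, Real.rpow_neg_one,
      div_eq_mul_inv]
  have hθsq : θ ^ 2 = (R ^ 2)⁻¹ * h ^ (2 / p * (p - 2)) := by
    rw [hθ, mul_pow, inv_pow, ← Real.rpow_natCast (h ^ _), ← Real.rpow_mul hh.le]
    congr 2
    push_cast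
    ring
  refine ⟨by rw [hδ]; positivity, by rw [hθ]; positivity, ?_, ?_, ?_⟩
  · rw [hδ, Real.mul_rpow hRpos.le (by positivity), Real.rpow_sub hRpos, hRp, ← Real.rpow_mul hh.le,
      hθsq, Real.rpow_two]
    field_simp
  · have : θ * δ = h := by
      rw [hθ, hδ]
      calc R⁻¹ * h ^ ((p - 2) / p) * (R * h ^ (2 / p))
          = (R⁻¹ * R) * (h ^ ((p - 2) / p) * h ^ (2 / p)) := by ring
        _ = h := by
          rw [inv_mul_cancel₀ hRpos.ne', ← Real.rpow_add hh, one_mul,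
            show (p - 2) / p + 2 / p = 1 by field_simp; ring, Real.rpow_one]
    rw [← mul_pow, this]
  · rw [hθ, hR, mul_inv, ← Real.rpow_neg hM.le, ← Real.rpow_neg hH.le, neg_neg, Real.rpow_sub hM,
      Real.rpow_neg hM.le, Real.rpow_natCast]
    ring

/-- A larger exponent costs a factor `D`, if the exponents differ by at most one. -/
theorem rpow_le_mul_rpow {h D a b : ℝ} (hh : 0 < h) (hhD : h ≤ D) (hD : 1 ≤ D) (hab : a ≤ b)
    (hab1 : b ≤ a + 1) : h ^ b ≤ D * h ^ a := by
  have h1 : h ^ b = h ^ (b - a) * h ^ a := by rw [← Real.rpow_add hh]; ring_nf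
  rw [h1]
  refine mul_le_mul_of_nonneg_right ?_ (by positivity)
  calc h ^ (b - a) ≤ D ^ (b - a) := Real.rpow_le_rpow hh.le hhD (by linarith)
    _ ≤ D ^ (1 : ℝ) := Real.rpow_le_rpow_of_exponent_le hD (by linarith)
    _ = D := Real.rpow_one D

theorem le_mul_pow_of_le_pow (hd : 1 ≤ d) {M c : ℝ} (hc : 0 < c) (hM : 0 ≤ M) (h : c ≤ M ^ d) :
    M ≤ (1 + 1 / c) * M ^ d := by
  have h0 : 0 ≤ M ^ d := by positivity
  rcases le_total 1 M with h1 | h1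
  · have h2 : M ≤ M ^ d := le_self_pow₀ h1 (by omega)
    have : 0 ≤ 1 / c * M ^ d := by positivity
    linarith
  · have h2 : 1 ≤ 1 / c * M ^ d := by rwa [one_div, inv_mul_eq_div, one_le_div hc]
    linarith

/-- Combination of the one-sided bounds for the error `e`, where `ρ` is the diameter of the domain
and `η = h^{(k+α)/(2+k+α)}`. -/
theorem abs_le_of_error_bounds {e R₀ ρ D M θ h η δ R : ℝ} (hR₀ : 0 < R₀) (hρ : 0 ≤ ρ) (hρD : ρ ≤ D)
    (hhD : h ≤ D) (hM : 0 < M) (hθ : 0 < θ) (hh : 0 < h) (hη : 0 < η) (hR : 0 < R)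
    (hhη : h ≤ D * η) (hδ : δ ≤ R * (D * η)) (hlow : e ≤ M * min (θ ^ 2) 1 * ρ ^ 2)
    (hup : -e ≤ M * (R₀ * (δ + h) + 2 * θ ^ 2 * ρ ^ 2 + h ^ 2 / 2)) (hbar : -e ≤ M * R₀ * ρ) :
    |e| ≤ (R₀ * D + 2 * D ^ 2) * (M * θ) + (R₀ * D + D ^ 2) * ((1 + R) * M * η) := by
  have hD : 0 < D := hh.trans_le hhD
  have hMRh : 0 ≤ (R₀ * D + D ^ 2) * ((1 + R) * M * η) := by positivity
  refine abs_le'.2 ⟨?_, ?_⟩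
  · have h2 : min (θ ^ 2) 1 ≤ θ := by
      rcases le_total θ 1 with h | h
      · exact (min_le_left _ _).trans (by nlinarith)
      · exact (min_le_right _ _).trans h
    have h3 : M * min (θ ^ 2) 1 * ρ ^ 2 ≤ M * θ * D ^ 2 := by gcongr
    have h4 : 0 ≤ (R₀ * D + D ^ 2) * (M * θ) := by positivity
    linarith
  · rcases le_total θ 1 with hθ1 | hθ1
    · have h2 : θ ^ 2 ≤ θ := by nlinarith
      have h5 : h ^ 2 ≤ D * (D * η) := by rw [sq]; gcongr
      have h6 : M * (R₀ * (δ + h) + 2 * θ ^ 2 * ρ ^ 2 + h ^ 2 / 2) ≤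
          M * (R₀ * (R * (D * η) + D * η) + 2 * θ * D ^ 2 + D * (D * η) / 2) := by gcongr
      have h7 : 0 ≤ R₀ * D * (M * θ) := by positivity
      have h8 : 0 ≤ D ^ 2 * (R * M * η) := by positivity
      have h9 : 0 ≤ D ^ 2 * (M * η) := by positivity
      linarith
    · have h3 : M * R₀ * ρ ≤ M * R₀ * D := by gcongr
      have h4 : M * R₀ * D * 1 ≤ M * R₀ * D * θ := by gcongr
      have h5 : 0 ≤ D ^ 2 * (M * θ) := by positivity
      linarith

theorem mul_add_mul_le_mul_add {a b F t T Q : ℝ} (ha : 0 ≤ a) (hb : 0 ≤ b) (hF : 0 ≤ F)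
    (hT : 0 ≤ T) (hQ : 0 ≤ Q) (ht : t ≤ F * T) : a * t + b * Q ≤ (a * F + b) * (T + Q) := by
  have h1 : 0 ≤ a * F * Q := by positivity
  have h2 : 0 ≤ b * T := by positivity
  have h3 : a * t ≤ a * (F * T) := by gcongr
  linarith

end TwoScaleMA

theorem theorem5p3 (d : ℕ) (hd : 1 ≤ d) (Ω : Set (Space d)) (hΩ : IsUniformlyConvexDomain Ω)
    (f₀ : ℝ) (hf₀ : 0 < f₀) (σ κ : ℝ) :
    ∃ C : ℝ, 0 < C ∧
      ∀ (k : ℕ) (α : ℝ), (k = 0 ∨ k = 1) → 0 < α → α ≤ 1 →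
      ∀ (f g u : Space d → ℝ), (∀ x ∈ Ω, f₀ ≤ f x) →
        IsConvexSolution Ω f g u → IsHolderClass (2 + k) α Ω u →
        0 < holderSeminorm (2 + k) α Ω u →
      ∀ (K : Geometry.SimplicialComplex ℝ (Space d)), IsMesh Ω σ κ K →
      ∀ (δ θ : ℝ),
        δ = scaleRatio k α Ω u * meshSize K ^ (2 / (2 + k + α)) →
        θ = (scaleRatio k α Ω u)⁻¹ * meshSize K ^ ((k + α) / (2 + k + α)) →
      ∀ (N : DirectionNet d θ) (uε : Space d → ℝ), IsDiscreteSolution K δ N f g uε →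
      ∀ x ∈ K.space,
        |u x - uε x| ≤
          C * (holderSeminorm (2 + k) α Ω u ^ (1 / (2 + k + α)) *
                w2InfSeminorm Ω u ^ (d - 1 / (2 + k + α)) +
              (1 + scaleRatio k α Ω u) * w2InfSeminorm Ω u) *
            meshSize K ^ ((k + α) / (2 + k + α)) := by
  obtain ⟨R₀, hR₀, hR⟩ := hΩ.enclosing
  set D := Metric.diam (closure Ω) + 1
  have hD1 : 1 ≤ D := le_add_of_nonneg_left Metric.diam_nonneg
  have hD0 : 0 < D := by linarith
  refine ⟨(R₀ * D + 2 * D ^ 2) * (1 + 1 / f₀) + (R₀ * D + D ^ 2), by positivity, ?_⟩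
  intro k α hk hα hα1 f g u hf hs hu hH K hK δ θ hδ hθ N uε hε x hx
  have S : Setting Ω k α f g u σ κ K := ⟨hd, hΩ.isOpen, hΩ.nonempty, hΩ.isBounded, hΩ.convex, hk, hα,
    hα1, fun x hx => hf₀.trans_le (hf x hx), hs, hu, hK, ⟨x, hx⟩⟩
  obtain ⟨x₀, hx₀⟩ := hΩ.nonempty
  have hMd := (hf x₀ hx₀).trans
    (le_w2InfSeminorm_pow hk hα hα1 hΩ.isOpen hΩ.isBounded hu hs hx₀)
  have hh := hK.meshSize_pos hd ⟨x, hx⟩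
  have hM0 : 0 ≤ w2InfSeminorm Ω u := w2InfSeminorm_nonneg
  have hM : 0 < w2InfSeminorm Ω u := hM0.lt_of_ne' fun h0 => by
    rw [h0, zero_pow (by omega)] at hMd
    linarith
  have hk1 : (k : ℝ) ≤ 1 := by rcases hk with rfl | rfl <;> simp
  have hk0 : (0 : ℝ) ≤ k := k.cast_nonneg
  have hkα : (k : ℝ) + α = 2 + k + α - 2 := by ring
  have hp : 2 < 2 + (k : ℝ) + α := by linarith
  rw [hkα] at hθ ⊢
  obtain ⟨hδ0, hθ0, hHδ, hhδ, hterm⟩ :=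
    scale_balance (d := d) hp hM hH hh (R := scaleRatio k α Ω u) rfl hδ hθ
  rw [← hkα] at hHδ
  have hM1 := le_mul_pow_of_le_pow hd hf₀ hM0 hMd
  have hhD : meshSize K ≤ D := by
    refine (Real.sSup_le ?_ Metric.diam_nonneg).trans (lt_add_one _).le
    rintro _ ⟨t, ht, rfl⟩
    exact Metric.diam_mono ((K.convexHull_subset_space ht.1).trans S.space_subset)
      hΩ.isBounded.closure
  have hRpos : 0 < scaleRatio k α Ω u := by unfold scaleRatio; positivity
  obtain ⟨y, hy⟩ : (frontier Ω).Nonempty := by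
    have : Nonempty (Fin d) := ⟨⟨0, hd⟩⟩
    refine nonempty_frontier_iff.2 ⟨hΩ.nonempty, fun h => ?_⟩
    exact hΩ.isBounded.isCompact_closure.ne_univ (by rw [h, closure_univ])
  have hlow := S.sub_le hδ0 hθ0 hM hHδ.le hε hx
  have hup := S.le_add hδ0 hθ0 hM hHδ.le hhδ.le hR₀ hR hε hx
  have hbar : uε x - u x ≤ w2InfSeminorm Ω u * R₀ * Metric.diam (closure Ω) := by
    refine (sub_le_iff_le_add'.2 (S.le_add_dist hδ0 hR hε hx hy)).trans ?_
    gcongr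
    exact S.dist_le_diam (S.space_subset hx) (frontier_subset_closure hy)
  rw [← neg_sub] at hup hbar
  set p := 2 + (k : ℝ) + α
  have hp0 : 0 < p := by linarith
  have hβ : (p - 2) / p = 1 - 2 / p := by field_simp
  have h2p : 1 / 2 ≤ 2 / p := by
    rw [div_le_div_iff₀ (by norm_num) hp0]
    linarith
  have h2p1 : 2 / p ≤ 1 := by
    rw [div_le_one hp0]
    exact hp.le
  have hhβ : meshSize K ≤ D * meshSize K ^ ((p - 2) / p) := by
    simpa using rpow_le_mul_rpow hh hhD hD1 (a := (p - 2) / p) (b := 1) (by linarith) (by linarith)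
  have hδβ : δ ≤ scaleRatio k α Ω u * (D * meshSize K ^ ((p - 2) / p)) := by
    rw [hδ]
    gcongr
    exact rpow_le_mul_rpow hh hhD hD1 (by linarith) (by linarith)
  have hβ0 : 0 < meshSize K ^ ((p - 2) / p) := by positivity
  refine (abs_le_of_error_bounds (D := D) hR₀ Metric.diam_nonneg (lt_add_one _).le hhD hM hθ0 hh hβ0 hRpos
    hhβ hδβ hlow hup hbar).trans ?_
  rw [mul_assoc (_ + _) (_ + _) (meshSize K ^ _), add_mul _ _ (meshSize K ^ _), hterm]
  refine mul_add_mul_le_mul_add ?_ ?_ ?_ ?_ ?_ ?_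
  any_goals positivity
  rw [← mul_assoc]
  exact mul_le_mul_of_nonneg_right hM1 hθ0.le
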